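/- Let $n\in\mathbb{N}_0$ and $\delta,\delta'\in\mathbb{C}$. A \emph{partial Brauer diagram} is a set partition of $\{1,\dots,n\}\sqcup\{1',\dots,n'\}$ into blocks of size at most two. The \emph{partial Brauer algebra} $\mathfrak{R}_n(\delta,\delta')$ is the $\mathbb{C}$-vector space with basis the partial Brauer diagrams and with bilinear multiplication given on diagrams as follows. Juxtapose $d$ (on the left) and $d'$ (on the right) by identifying the vertex $i'$ of $d$ with the vertex $i$ of $d'$ for all $i$; let $d\circ d'$ be the partition of the outer vertices (the unprimed vertices of $d$ and the primed vertices of $d'$) induced by the connected components of the juxtaposition. Then $d\cdot d'=\delta^{k}\,{\delta'}^{m}\,(d\circ d')$, where, among the connected components that contain no outer vertex, $m$ is the number of those that are open strings (they contain a vertex which is a singleton block of $d$ or of $d'$) and $k$ is the number of the others (closed loops). This is an associative unital algebra. The algebra $\mathfrak{R}_n(\delta,\delta')$ is generically semisimple: for every $n\in\mathbb{N}_0$ there is a finite set $S\subset\mathbb{C}$ such that $\mathfrak{R}_n(\delta,\delta')$ is semisimple for all $\delta\in\mathbb{C}\setminus S$ and all $\delta'\in\mathbb{C}\setminus\{0\}$;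 in particular, it is semisimple for all $(\delta,\delta')$ in a non-empty Zariski-open subset of $\mathbb{C}^2$. -/

import Mathlib

namespace PartialBrauer

/-- Every block of the partition has at most two elements. -/
def IsPairing {V : Type*} (r : Setoid V) : Prop :=
  ∀ x y z, r x y → r x z → x = y ∨ x = z ∨ y = z

/-- The block of `x` is the singleton `{x}`. -/
def IsSingleton {V : Type*} (r : Setoid V) (x : V) : Prop :=
  ∀ y, r x y → y = x

theorem map_le {V W : Type*} {r : Setoid V} {f : V → W} {t : Setoid W} :
    r.map f ≤ t ↔ r ≤ t.comap f := by
  constructor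
  · intro h x y hxy
    exact h (Relation.EqvGen.rel _ _ ⟨x, y, hxy, rfl, rfl⟩)
  · intro h
    refine Setoid.eqvGen_le ?_
    rintro _ _ ⟨a, b, hab, rfl, rfl⟩
    exact h hab

theorem map_rel {V W : Type*} {r : Setoid V} {f : V → W} {x y : V} (h : r x y) :
    r.map f (f x) (f y) :=
  Relation.EqvGen.rel _ _ ⟨x, y, h, rfl, rfl⟩

theorem map_iff {V W : Type*} {r : Setoid V} {f : V → W} (hf : f.Injective) {x y : W} :
    r.map f x y ↔ x = y ∨ ∃ a b, f a = x ∧ f b = y ∧ r a b := by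
  have := Setoid.coe_map_of_ker_le r f (by
    intro a b h
    have : a = b := hf h
    subst this
    exact r.refl' a)
  rw [this]
  constructor
  · rintro (⟨a, b, h, h1, h2⟩ | h)
    · exact Or.inr ⟨a, b, h1, h2, h⟩
    · exact Or.inl h
  · rintro (h | ⟨a, b, h1, h2, h⟩)
    · exact Or.inr h
    · exact Or.inl ⟨a, b, h, h1, h2⟩

theorem map_map {U V W : Type*} (r : Setoid U) (f : U → V) (g : V → W) :
    (r.map f).map g = r.map (g ∘ f) := by
  refine eq_of_forall_ge_iff fun t => ?_
  rw [map_le, map_le, map_le, Setoid.comap_comp]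

theorem map_sup {V W : Type*} (r s : Setoid V) (f : V → W) :
    (r ⊔ s).map f = r.map f ⊔ s.map f := by
  refine eq_of_forall_ge_iff fun t => ?_
  rw [map_le, sup_le_iff, sup_le_iff, map_le, map_le]

/-- Restricting a join to the complement of a set of vertices which the second partition leaves
alone. -/
theorem comap_sup {V U : Type*} (p t : Setoid V) (e : U → V)
    (ht : ∀ x y, t x y → x = y ∨ x ∈ Set.range e ∧ y ∈ Set.range e) :
    (p ⊔ t).comap e = p.comap e ⊔ t.comap e := by
  apply le_antisymm
  · have htr : ∀ a b : U, p (e a) (e b) → (p.comap e ⊔ t.comap e) a b :=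
      fun a b h => (le_sup_left : p.comap e ≤ _) h
    let E : Setoid V :=
      { r := fun x y => p x y ∨ ∃ a b, p x (e a) ∧ (p.comap e ⊔ t.comap e) a b ∧ p (e b) y
        iseqv := by
          refine ⟨fun x => Or.inl (p.refl' x), ?_, ?_⟩
          · rintro x y (h | ⟨a, b, h1, h2, h3⟩)
            · exact Or.inl (p.symm' h)
            · exact Or.inr ⟨b, a, p.symm' h3, Setoid.symm' _ h2, p.symm' h1⟩
          · rintro x y z (h | ⟨a, b, h1, h2, h3⟩) (h' | ⟨a', b', h1', h2', h3'⟩)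
            · exact Or.inl (p.trans' h h')
            · exact Or.inr ⟨a', b', p.trans' h h1', h2', h3'⟩
            · exact Or.inr ⟨a, b, h1, h2, p.trans' h3 h'⟩
            · exact Or.inr ⟨a, b', h1, Setoid.trans' _ h2
                (Setoid.trans' _ (htr _ _ (p.trans' h3 h1')) h2'), h3'⟩ }
    have hE : p ⊔ t ≤ E := by
      refine sup_le (fun x y h => Or.inl h) (fun x y h => ?_)
      rcases ht x y h with rfl | ⟨⟨a, rfl⟩, ⟨b, rfl⟩⟩
      · exact Or.inl (p.refl' x)
      · exact Or.inr ⟨a, b, p.refl' _, (le_sup_right : t.comap e ≤ _) h, p.refl' _⟩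
    intro a b h
    rcases hE h with h | ⟨a', b', h1, h2, h3⟩
    · exact htr _ _ h
    · exact Setoid.trans' _ (htr _ _ h1) (Setoid.trans' _ h2 (htr _ _ h3))
  · exact sup_le (fun a b h => (le_sup_left : p ≤ p ⊔ t) h)
      (fun a b h => (le_sup_right : t ≤ p ⊔ t) h)

/-- Blocks of `r` are those which avoid the range of `e` and those which meet it. -/
theorem card_quotient {V U : Type*} [Finite V] (r : Setoid V) (e : U → V) :
    Nat.card (Quotient r) =
      Nat.card {c : Quotient r // ∀ u, Quotient.mk r (e u) ≠ c} +
        Nat.card (Quotient (r.comap e)) := by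
  classical
  rw [Nat.card_congr (Setoid.comapQuotientEquiv e r)]
  rw [← Nat.card_congr (Equiv.sumCompl fun c : Quotient r => ∀ u, Quotient.mk r (e u) ≠ c),
    Nat.card_sum]
  congr 1
  apply Nat.card_congr
  refine Equiv.subtypeEquivRight fun c => ?_
  simp [Set.mem_range, Quotient.mk'']

/-- Blocks inside the forgotten set of vertices are not affected by the second partition. -/
theorem card_inner {U V W : Type*} (s : Setoid U) (t : Setoid V) (f : U → V) (hf : f.Injective)
    {X : Type*} (o : X → U) (e : W → V)
    (ht : ∀ x y, t x y → x = y ∨ x ∈ Set.range e ∧ y ∈ Set.range e)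
    (hc : ∀ v, v ∈ Set.range e ∨ v ∈ Set.range f)
    (ho : ∀ u, f u ∈ Set.range e ↔ u ∈ Set.range o) :
    Nat.card {c : Quotient s // ∀ x, Quotient.mk s (o x) ≠ c} =
      Nat.card {c : Quotient (s.map f ⊔ t) // ∀ w, Quotient.mk _ (e w) ≠ c} := by
  have hle : s ≤ (s.map f ⊔ t).comap f := fun a b h =>
    (le_sup_left : s.map f ≤ _) (map_rel h)
  have key : ∀ u, (∀ x, ¬ s (o x) u) → ∀ v, (s.map f ⊔ t) (f u) v → ∃ u', v = f u' ∧ s u u' := by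
    intro u hu
    let E : Setoid V :=
      { r := fun x y => (∃ u', x = f u' ∧ s u u') ↔ (∃ u', y = f u' ∧ s u u')
        iseqv := ⟨fun _ => Iff.rfl, fun h => h.symm, fun h h' => h.trans h'⟩ }
    have hE : s.map f ⊔ t ≤ E := by
      refine sup_le ?_ ?_
      · rw [map_le]
        intro a b hab
        constructor
        · rintro ⟨u', h1, h2⟩
          cases hf h1
          exact ⟨b, rfl, s.trans' h2 hab⟩
        · rintro ⟨u', h1, h2⟩
          cases hf h1
          exact ⟨a, rfl, s.trans' h2 (s.symm' hab)⟩
      · intro x y hxy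
        have hn : ∀ z, z ∈ Set.range e → ¬ ∃ u', z = f u' ∧ s u u' := by
          rintro z hz ⟨u', rfl, h⟩
          obtain ⟨x, rfl⟩ := (ho u').1 hz
          exact hu x (s.symm' h)
        rcases ht x y hxy with rfl | ⟨hx, hy⟩
        · exact Iff.rfl
        · exact iff_of_false (hn _ hx) (hn _ hy)
    intro v hv
    exact (hE hv).1 ⟨u, rfl, s.refl' u⟩
  refine Nat.card_congr (Equiv.ofBijective (fun c => ⟨Quotient.map f (fun a b h => hle h) c.1, ?_⟩) ⟨?_, ?_⟩)
  · obtain ⟨c, hc'⟩ := c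
    induction c using Quotient.inductionOn with
    | h u =>
      intro w hw
      have hw' : (s.map f ⊔ t) (f u) (e w) := Setoid.symm' _ (Quotient.exact hw)
      obtain ⟨u', h1, h2⟩ := key u (fun x hx => hc' x (Quotient.sound hx)) _ hw'
      obtain ⟨x, rfl⟩ := (ho u').1 ⟨w, h1⟩
      exact hc' x (Quotient.sound (s.symm' h2))
  · rintro ⟨c, hc1⟩ ⟨d, hd1⟩ h
    induction c using Quotient.inductionOn with
    | h u =>
      induction d using Quotient.inductionOn with
      | h v =>
        have h' : (s.map f ⊔ t) (f u) (f v) := Quotient.exact (congrArg Subtype.val h)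
        obtain ⟨u', h1, h2⟩ := key u (fun x hx => hc1 x (Quotient.sound hx)) _ h'
        cases hf h1
        exact Subtype.ext (Quotient.sound h2)
  · rintro ⟨c, hc1⟩
    induction c using Quotient.inductionOn with
    | h v =>
      rcases hc v with ⟨w, rfl⟩ | ⟨u, rfl⟩
      · exact absurd rfl (hc1 w)
      · refine ⟨⟨Quotient.mk s u, fun x hx => ?_⟩, rfl⟩
        obtain ⟨w, hw⟩ := (ho (o x)).2 ⟨x, rfl⟩
        apply hc1 w
        rw [hw]
        exact Quotient.sound (hle (Quotient.exact hx))

/-! ### Chains: joins of two pairings -/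

theorem exists_partner {V : Type*} {p : Setoid V} (hp : IsPairing p) :
    ∃ σ : Equiv.Perm V, σ * σ = 1 ∧ ∀ x y, p x y ↔ y = x ∨ y = σ x := by
  classical
  have h : ∀ x, ∃ y, p x y ∧ ∀ z, p x z → z = x ∨ z = y := by
    intro x
    by_cases hx : ∃ y, p x y ∧ x ≠ y
    · obtain ⟨y, hxy, hne⟩ := hx
      refine ⟨y, hxy, fun z hz => ?_⟩
      rcases hp x y z hxy hz with h | h | h
      · exact absurd h hne
      · exact Or.inl h.symm
      · exact Or.inr h.symm
    · push Not at hx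
      exact ⟨x, p.refl' x, fun z hz => Or.inl (hx z hz).symm⟩
  choose f hf1 hf2 using h
  have hinv : Function.Involutive f := by
    intro x
    by_cases hx : f x = x
    · rw [hx, hx]
    · rcases hf2 (f x) x (p.symm' (hf1 x)) with h | h
      · exact absurd h.symm hx
      · exact h.symm
  refine ⟨hinv.toPerm f, ?_, fun x y => ⟨hf2 x y, ?_⟩⟩
  · ext x
    simp [hinv x]
  · rintro (rfl | rfl)
    · exact p.refl' _
    · exact hf1 x

theorem singleton_iff {V : Type*} {p : Setoid V} {σ : Equiv.Perm V}
    (h : ∀ x y, p x y ↔ y = x ∨ y = σ x) (x : V) : IsSingleton p x ↔ σ x = x := by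
  constructor
  · intro hx
    exact hx _ ((h _ _).2 (Or.inr rfl))
  · intro hx y hy
    rcases (h _ _).1 hy with h' | h'
    · exact h'
    · rw [h', hx]

/-- Following a chain from one of its ends. -/
theorem chain {V : Type*} {p q : Setoid V} {σ τ : Equiv.Perm V}
    (hσ : σ * σ = 1) (hτ : τ * τ = 1)
    (hp : ∀ x y, p x y ↔ y = x ∨ y = σ x) (hq : ∀ x y, q x y ↔ y = x ∨ y = τ x)
    {x : V} (hx : σ x = x) :
    (∀ y, (p ⊔ q) x y → ∃ k : ℤ, y = ((σ * τ) ^ k) x) ∧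
    (∀ k : ℤ, σ (((σ * τ) ^ k) x) = ((σ * τ) ^ (-k)) x) ∧
    (∀ k : ℤ, τ (((σ * τ) ^ k) x) = ((σ * τ) ^ (-k - 1)) x) := by
  have hσ' : σ⁻¹ = σ := inv_eq_of_mul_eq_one_left hσ
  have hτ' : τ⁻¹ = τ := inv_eq_of_mul_eq_one_left hτ
  have h1 : ∀ k : ℤ, σ * (σ * τ) ^ k = (σ * τ) ^ (-k) * σ := by
    intro k
    have := @conj_zpow _ _ k σ (σ * τ)
    rw [← mul_assoc, hσ, one_mul, ← inv_inv (τ * σ⁻¹), inv_zpow, ← zpow_neg, mul_inv_rev,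
      inv_inv, hτ'] at this
    rw [this]
    simp
  have h2 : ∀ k : ℤ, τ * (σ * τ) ^ k = (σ * τ) ^ (-k - 1) * σ := by
    intro k
    have h3 : τ = σ * (σ * τ) := by rw [← mul_assoc, hσ, one_mul]
    calc τ * (σ * τ) ^ k = σ * (σ * τ) ^ (k + 1) := by
          rw [add_comm, zpow_add, zpow_one, ← mul_assoc, ← h3]
      _ = (σ * τ) ^ (-(k + 1)) * σ := h1 _
      _ = _ := by rw [neg_add']
  have a1 : ∀ k : ℤ, σ (((σ * τ) ^ k) x) = ((σ * τ) ^ (-k)) x := by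
    intro k
    have := congrArg (fun g : Equiv.Perm V => g x) (h1 k)
    simpa only [Equiv.Perm.mul_apply, hx] using this
  have a2 : ∀ k : ℤ, τ (((σ * τ) ^ k) x) = ((σ * τ) ^ (-k - 1)) x := by
    intro k
    have := congrArg (fun g : Equiv.Perm V => g x) (h2 k)
    simpa only [Equiv.Perm.mul_apply, hx] using this
  refine ⟨?_, a1, a2⟩
  let E : Setoid V :=
    { r := fun y z => (∃ k : ℤ, y = ((σ * τ) ^ k) x) ↔ (∃ k : ℤ, z = ((σ * τ) ^ k) x)
      iseqv := ⟨fun _ => Iff.rfl, fun h => h.symm, fun h h' => h.trans h'⟩ }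
  have b1 : ∀ y, (∃ k : ℤ, y = ((σ * τ) ^ k) x) → ∃ k : ℤ, σ y = ((σ * τ) ^ k) x := by
    rintro _ ⟨k, rfl⟩
    exact ⟨-k, a1 k⟩
  have b2 : ∀ y, (∃ k : ℤ, y = ((σ * τ) ^ k) x) → ∃ k : ℤ, τ y = ((σ * τ) ^ k) x := by
    rintro _ ⟨k, rfl⟩
    exact ⟨-k - 1, a2 k⟩
  have hss : ∀ y, σ (σ y) = y := fun y => congrArg (fun g : Equiv.Perm V => g y) hσ
  have htt : ∀ y, τ (τ y) = y := fun y => congrArg (fun g : Equiv.Perm V => g y) hτ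
  have hE : p ⊔ q ≤ E := by
    refine sup_le ?_ ?_
    · intro y z h
      rcases (hp y z).1 h with rfl | rfl
      · exact Iff.rfl
      · exact ⟨b1 y, fun h => by simpa only [hss] using b1 _ h⟩
    · intro y z h
      rcases (hq y z).1 h with rfl | rfl
      · exact Iff.rfl
      · exact ⟨b2 y, fun h => by simpa only [htt] using b2 _ h⟩
  intro y hy
  exact (hE hy).1 ⟨0, by simp⟩

theorem zpow_apply_eq_iff {V : Type*} (ρ : Equiv.Perm V) (x : V) :
    ∃ m : ℤ, ∀ k l : ℤ, (ρ ^ k) x = (ρ ^ l) x ↔ m ∣ k - l := by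
  refine ⟨(Function.minimalPeriod (fun x => ρ • x) x : ℤ), fun k l => ?_⟩
  rw [← MulAction.zpow_smul_eq_iff_minimalPeriod_dvd, sub_eq_neg_add, zpow_add, zpow_neg, mul_smul,
    inv_smul_eq_iff]
  rfl

/-- A chain has at most two ends of the same kind. -/
theorem ends_same {V : Type*} {p q : Setoid V} (hp : IsPairing p) (hq : IsPairing q) {x y z : V}
    (hx : IsSingleton p x) (hy : IsSingleton p y) (hz : IsSingleton p z)
    (hxy : (p ⊔ q) x y) (hxz : (p ⊔ q) x z) : x = y ∨ x = z ∨ y = z := by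
  obtain ⟨σ, hσ, hpσ⟩ := exists_partner hp
  obtain ⟨τ, hτ, hqτ⟩ := exists_partner hq
  rw [singleton_iff hpσ] at hx hy hz
  obtain ⟨c1, c2, -⟩ := chain hσ hτ hpσ hqτ hx
  obtain ⟨k, rfl⟩ := c1 y hxy
  obtain ⟨l, rfl⟩ := c1 z hxz
  rw [c2] at hy hz
  obtain ⟨m, hm⟩ := zpow_apply_eq_iff (σ * τ) x
  rw [hm] at hy hz
  have h0 : ((σ * τ) ^ (0 : ℤ)) x = x := by simp
  have e1 := hm 0 k
  have e2 := hm 0 l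
  rw [h0] at e1 e2
  rw [e1, e2, hm]
  obtain ⟨u, hu⟩ := hy
  obtain ⟨v, hv⟩ := hz
  rcases Int.even_or_odd' u with ⟨a, rfl | rfl⟩
  · exact Or.inl ⟨a, by linarith⟩
  rcases Int.even_or_odd' v with ⟨b, rfl | rfl⟩
  · exact Or.inr (Or.inl ⟨b, by linarith⟩)
  · exact Or.inr (Or.inr ⟨b - a, by linarith⟩)

/-- A chain with two ends of one kind has none of the other kind. -/
theorem ends_mixed {V : Type*} {p q : Setoid V} (hp : IsPairing p) (hq : IsPairing q) {x y z : V}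
    (hx : IsSingleton p x) (hy : IsSingleton p y) (hz : IsSingleton q z)
    (hxy : (p ⊔ q) x y) (hxz : (p ⊔ q) x z) : x = y := by
  obtain ⟨σ, hσ, hpσ⟩ := exists_partner hp
  obtain ⟨τ, hτ, hqτ⟩ := exists_partner hq
  rw [singleton_iff hpσ] at hx hy
  rw [singleton_iff hqτ] at hz
  obtain ⟨c1, c2, c3⟩ := chain hσ hτ hpσ hqτ hx
  obtain ⟨k, rfl⟩ := c1 y hxy
  obtain ⟨l, rfl⟩ := c1 z hxz
  rw [c2] at hy
  rw [c3] at hz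
  obtain ⟨m, hm⟩ := zpow_apply_eq_iff (σ * τ) x
  rw [hm] at hy hz
  have h0 : ((σ * τ) ^ (0 : ℤ)) x = x := by simp
  have e1 := hm 0 k
  rw [h0] at e1
  rw [e1]
  obtain ⟨u, hu⟩ := hy
  obtain ⟨v, hv⟩ := hz
  rcases Int.even_or_odd' u with ⟨a, rfl | rfl⟩
  · exact ⟨a, by linarith⟩
  · exfalso
    have hme : Even m := by
      have : m = 2 * (-k - m * a) := by linarith
      exact ⟨-k - m * a, by linarith⟩
    obtain ⟨w, rfl⟩ := hme
    have : 2 * (-l - w * v) = 1 := by linarith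
    omega

/-- Parity of the number of singletons inside a block of a coarser partition. -/
theorem card_singleton_mod {V : Type*} [Finite V] {p t : Setoid V} (hp : IsPairing p)
    (hle : p ≤ t) (c : Quotient t) :
    Nat.card {x : V // Quotient.mk t x = c} % 2 =
      Nat.card {x : {x : V // IsSingleton p x} // Quotient.mk t x.1 = c} % 2 := by
  classical
  obtain ⟨σ, hσ, hpσ⟩ := exists_partner hp
  have hss : ∀ y, σ (σ y) = y := fun y => congrArg (fun g : Equiv.Perm V => g y) hσ
  let f : Function.End {x : V // Quotient.mk t x = c} := fun x =>
    ⟨σ x.1, by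
      refine Eq.trans ?_ x.2
      exact Quotient.sound (t.symm' (hle ((hpσ _ _).2 (Or.inr rfl))))⟩
  have hf : f ^ 2 ^ 1 = 1 := by
    funext x
    apply Subtype.ext
    rw [pow_one, pow_two]
    exact hss x.1
  have := Fintype.ofFinite {x : V // Quotient.mk t x = c}
  have := Equiv.Perm.card_fixedPoints_modEq (p := 2) hf
  rw [← Nat.card_eq_fintype_card, ← Nat.card_eq_fintype_card] at this
  rw [this]
  congr 1
  refine Nat.card_congr
    { toFun := fun x => ⟨⟨x.1.1, (singleton_iff hpσ _).2 (congrArg Subtype.val x.2)⟩, x.1.2⟩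
      invFun := fun x => ⟨⟨x.1.1, x.2⟩, Subtype.ext ((singleton_iff hpσ _).1 x.1.2)⟩
      left_inv := fun _ => rfl
      right_inv := fun _ => rfl }

theorem card_ends_le {V : Type*} [Finite V] {p q : Setoid V} (hp : IsPairing p) (hq : IsPairing q)
    (c : Quotient (p ⊔ q)) :
    Nat.card {x : {x : V // IsSingleton p x} // Quotient.mk (p ⊔ q) x.1 = c} ≤ 2 := by
  classical
  have := Fintype.ofFinite {x : {x : V // IsSingleton p x} // Quotient.mk (p ⊔ q) x.1 = c}
  rw [Nat.card_eq_fintype_card]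
  by_contra! h
  obtain ⟨x, y, z, h1, h2, h3⟩ := Fintype.two_lt_card_iff.1 h
  have := ends_same hp hq x.1.2 y.1.2 z.1.2 (Quotient.exact (x.2.trans y.2.symm))
    (Quotient.exact (x.2.trans z.2.symm))
  simp only [Subtype.val_inj] at this
  tauto

theorem card_ends_mixed {V : Type*} [Finite V] {p q : Setoid V} (hp : IsPairing p)
    (hq : IsPairing q) (c : Quotient (p ⊔ q)) :
    Nat.card {x : {x : V // IsSingleton p x} // Quotient.mk (p ⊔ q) x.1 = c} ≤ 1 ∨
      Nat.card {x : {x : V // IsSingleton q x} // Quotient.mk (p ⊔ q) x.1 = c} = 0 := by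
  classical
  by_contra! h
  obtain ⟨h1, h2⟩ := h
  obtain ⟨⟨⟨z, hz⟩, rfl⟩⟩ := (Nat.card_ne_zero.1 h2).1
  have := Fintype.ofFinite
    {x : {x : V // IsSingleton p x} // Quotient.mk (p ⊔ q) x.1 = Quotient.mk (p ⊔ q) z}
  rw [Nat.card_eq_fintype_card] at h1
  obtain ⟨x, y, hxy⟩ := Fintype.one_lt_card_iff.1 h1
  have := ends_mixed hp hq x.1.2 y.1.2 hz (Quotient.exact (x.2.trans y.2.symm))
    (Quotient.exact x.2)
  simp only [Subtype.val_inj] at this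
  exact hxy this

/-- Every chain which has an end has exactly two ends. -/
theorem card_ends {V : Type*} [Finite V] {p q : Setoid V} (hp : IsPairing p) (hq : IsPairing q) :
    Nat.card {x : V // IsSingleton p x} + Nat.card {x : V // IsSingleton q x} =
      2 * Nat.card {c : Quotient (p ⊔ q) //
        ∃ x, Quotient.mk (p ⊔ q) x = c ∧ (IsSingleton p x ∨ IsSingleton q x)} := by
  classical
  have := Fintype.ofFinite (Quotient (p ⊔ q))
  rw [← Nat.card_congr (Equiv.sigmaFiberEquiv
      fun x : {x : V // IsSingleton p x} => Quotient.mk (p ⊔ q) x.1), Nat.card_sigma,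
    ← Nat.card_congr (Equiv.sigmaFiberEquiv
      fun x : {x : V // IsSingleton q x} => Quotient.mk (p ⊔ q) x.1), Nat.card_sigma,
    ← Finset.sum_add_distrib, Nat.card_eq_fintype_card, Fintype.card_subtype, Finset.card_filter,
    Finset.mul_sum]
  refine Finset.sum_congr rfl fun c _ => ?_
  have m1 := card_singleton_mod hp (le_sup_left : p ≤ p ⊔ q) c
  have m2 := card_singleton_mod hq (le_sup_right : q ≤ p ⊔ q) c
  have l1 := card_ends_le hp hq c
  have l2 : Nat.card {x : {x : V // IsSingleton q x} // Quotient.mk (p ⊔ q) x.1 = c} ≤ 2 := by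
    have := fun c => card_ends_le hq hp c
    rw [sup_comm] at this
    exact this c
  have x1 := card_ends_mixed hp hq c
  have x2 : Nat.card {x : {x : V // IsSingleton q x} // Quotient.mk (p ⊔ q) x.1 = c} ≤ 1 ∨
      Nat.card {x : {x : V // IsSingleton p x} // Quotient.mk (p ⊔ q) x.1 = c} = 0 := by
    have := fun c => card_ends_mixed hq hp c
    rw [sup_comm] at this
    exact this c
  split_ifs with h
  · obtain ⟨x, hx, h | h⟩ := h
    · have : Nat.card {x : {x : V // IsSingleton p x} // Quotient.mk (p ⊔ q) x.1 = c} ≠ 0 :=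
        Nat.card_ne_zero.2 ⟨⟨⟨⟨x, h⟩, hx⟩⟩, inferInstance⟩
      omega
    · have : Nat.card {x : {x : V // IsSingleton q x} // Quotient.mk (p ⊔ q) x.1 = c} ≠ 0 :=
        Nat.card_ne_zero.2 ⟨⟨⟨⟨x, h⟩, hx⟩⟩, inferInstance⟩
      omega
  · have e1 : IsEmpty {x : {x : V // IsSingleton p x} // Quotient.mk (p ⊔ q) x.1 = c} :=
      ⟨fun x => h ⟨x.1.1, x.2, Or.inl x.1.2⟩⟩
    have e2 : IsEmpty {x : {x : V // IsSingleton q x} // Quotient.mk (p ⊔ q) x.1 = c} :=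
      ⟨fun x => h ⟨x.1.1, x.2, Or.inr x.1.2⟩⟩
    simp

/-- The number of blocks of a pairing. -/
theorem card_blocks {V : Type*} [Finite V] {p : Setoid V} (hp : IsPairing p) :
    2 * Nat.card (Quotient p) = Nat.card {x : V // IsSingleton p x} + Nat.card V := by
  have hb : ∀ x : V, IsSingleton (⊥ : Setoid V) x := fun x y (h : x = y) => h.symm
  have hbp : IsPairing (⊥ : Setoid V) := fun x y z h _ => Or.inl (hb x y h).symm
  have h := card_ends hp hbp
  rw [sup_bot_eq, Nat.card_congr (Equiv.subtypeUnivEquiv hb)] at h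
  rw [h]
  congr 1
  refine (Nat.card_congr (Equiv.subtypeUnivEquiv ?_)).symm
  intro c
  induction c using Quotient.inductionOn with
  | h x => exact ⟨x, rfl, Or.inr (hb x)⟩

theorem isPairing_map {V W : Type*} {r : Setoid V} (hr : IsPairing r) {f : V → W}
    (hf : f.Injective) : IsPairing (r.map f) := by
  intro x y z h1 h2
  rcases (map_iff hf).1 h1 with h | ⟨a, b, rfl, rfl, h⟩
  · exact Or.inl h
  rcases (map_iff hf).1 h2 with h' | ⟨a', b', ha, rfl, h'⟩
  · exact Or.inr (Or.inl h')
  cases hf ha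
  rcases hr _ _ _ h h' with h | h | h <;> simp [h]

theorem isSingleton_map {V W : Type*} {r : Setoid V} {f : V → W}
    (hf : f.Injective) (x : V) : IsSingleton (r.map f) (f x) ↔ IsSingleton r x := by
  constructor
  · intro h y hy
    exact hf (h _ (map_rel hy))
  · intro h y hy
    rcases (map_iff hf).1 hy with h' | ⟨a, b, ha, rfl, h'⟩
    · exact h'.symm
    · cases hf ha
      rw [h b h']

theorem isSingleton_map_of_notMem {V W : Type*} {r : Setoid V} {f : V → W}
    (hf : f.Injective) {x : W} (hx : x ∉ Set.range f) : IsSingleton (r.map f) x := by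
  intro y hy
  rcases (map_iff hf).1 hy with h' | ⟨a, b, ha, rfl, h'⟩
  · exact h'.symm
  · exact absurd ⟨a, ha⟩ hx

/-! ### Juxtaposition and composition of partitions -/

/-- The left diagram inside the juxtaposition (left, middle and right vertices). -/
def leftIncl {X Y Z : Type*} : X ⊕ Y → X ⊕ (Y ⊕ Z) := Sum.map id Sum.inl

/-- The right diagram inside the juxtaposition. -/
def rightIncl {X Y Z : Type*} : Y ⊕ Z → X ⊕ (Y ⊕ Z) := Sum.inr

/-- The outer (left and right) vertices inside the juxtaposition. -/
def outerIncl {X Y Z : Type*} : X ⊕ Z → X ⊕ (Y ⊕ Z) := Sum.map id Sum.inr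

/-- The middle vertices inside the juxtaposition. -/
def midIncl {X Y Z : Type*} : Y → X ⊕ (Y ⊕ Z) := Sum.inr ∘ Sum.inl

/-- The partition into connected components of the juxtaposition of `r` (on the left) and `s`
(on the right), where the right vertices of `r` are identified with the left vertices of `s`. -/
def juxtapose {X Y Z : Type*} (r : Setoid (X ⊕ Y)) (s : Setoid (Y ⊕ Z)) :
    Setoid (X ⊕ (Y ⊕ Z)) :=
  r.map leftIncl ⊔ s.map rightIncl

/-- The partition of the outer vertices induced by the juxtaposition. -/
def comp {X Y Z : Type*} (r : Setoid (X ⊕ Y)) (s : Setoid (Y ⊕ Z)) : Setoid (X ⊕ Z) :=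
  (juxtapose r s).comap outerIncl

/-- A connected component of the juxtaposition is removed if it contains no outer vertex. -/
def IsRemoved {X Y Z : Type*} (r : Setoid (X ⊕ Y)) (s : Setoid (Y ⊕ Z))
    (c : Quotient (juxtapose r s)) : Prop :=
  ∀ x : X ⊕ Z, Quotient.mk (juxtapose r s) (outerIncl x) ≠ c

/-- A connected component has an end on the equator, that is, it contains a middle vertex which is
a singleton of one of the two diagrams. -/
def HasEnd {X Y Z : Type*} (r : Setoid (X ⊕ Y)) (s : Setoid (Y ⊕ Z))
    (c : Quotient (juxtapose r s)) : Prop :=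
  ∃ y : Y, Quotient.mk (juxtapose r s) (midIncl y) = c ∧
    (IsSingleton r (Sum.inr y) ∨ IsSingleton s (Sum.inl y))

/-- The number of loops removed in straightening the juxtaposition of `r` and `s`. -/
noncomputable def numLoops {X Y Z : Type*} (r : Setoid (X ⊕ Y)) (s : Setoid (Y ⊕ Z)) : ℕ :=
  Nat.card {c : Quotient (juxtapose r s) // IsRemoved r s c ∧ ¬ HasEnd r s c}

/-- The number of open strings removed in straightening the juxtaposition of `r` and `s`. -/
noncomputable def numStrings {X Y Z : Type*} (r : Setoid (X ⊕ Y)) (s : Setoid (Y ⊕ Z)) : ℕ :=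
  Nat.card {c : Quotient (juxtapose r s) // IsRemoved r s c ∧ HasEnd r s c}

theorem leftIncl_injective {X Y Z : Type*} : (leftIncl : X ⊕ Y → X ⊕ (Y ⊕ Z)).Injective :=
  Function.Injective.sumMap Function.injective_id Sum.inl_injective

theorem rightIncl_injective {X Y Z : Type*} : (rightIncl : Y ⊕ Z → X ⊕ (Y ⊕ Z)).Injective :=
  Sum.inr_injective

theorem outerIncl_injective {X Y Z : Type*} : (outerIncl : X ⊕ Z → X ⊕ (Y ⊕ Z)).Injective :=
  Function.Injective.sumMap Function.injective_id Sum.inr_injective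

theorem outer_isEnd {X Y Z : Type*} (r : Setoid (X ⊕ Y)) (s : Setoid (Y ⊕ Z)) (x : X ⊕ Z) :
    IsSingleton (r.map leftIncl) (outerIncl x : X ⊕ (Y ⊕ Z)) ∨
      IsSingleton (s.map rightIncl) (outerIncl x : X ⊕ (Y ⊕ Z)) := by
  rcases x with x | z
  · refine Or.inr (isSingleton_map_of_notMem rightIncl_injective ?_)
    simp [rightIncl, outerIncl]
  · refine Or.inl (isSingleton_map_of_notMem leftIncl_injective ?_)
    simp [leftIncl, outerIncl]

/-- The composition of partial Brauer partitions is a partial Brauer partition. -/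
theorem isPairing_comp {X Y Z : Type*} {r : Setoid (X ⊕ Y)} {s : Setoid (Y ⊕ Z)}
    (hr : IsPairing r) (hs : IsPairing s) : IsPairing (comp r s) := by
  have hp := isPairing_map hr (leftIncl_injective (Z := Z))
  have hq := isPairing_map hs (rightIncl_injective (X := X))
  intro x y z hxy hxz
  have hxy' : (r.map leftIncl ⊔ s.map rightIncl) (outerIncl x) (outerIncl y) := hxy
  have hxz' : (r.map leftIncl ⊔ s.map rightIncl) (outerIncl x) (outerIncl z) := hxz
  have hyz' := Setoid.trans' _ (Setoid.symm' _ hxy') hxz'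
  have cxy := hxy'
  have cxz := hxz'
  have cyz := hyz'
  rw [sup_comm] at cxy cxz cyz
  have inj := fun a b => (outerIncl_injective (X := X) (Y := Y) (Z := Z)).eq_iff (a := a) (b := b)
  rw [← inj x y, ← inj x z, ← inj y z]
  rcases outer_isEnd r s x with hx | hx <;> rcases outer_isEnd r s y with hy | hy <;>
    rcases outer_isEnd r s z with hz | hz
  · exact ends_same hp hq hx hy hz hxy' hxz'
  · exact Or.inl (ends_mixed hp hq hx hy hz hxy' hxz')
  · exact Or.inr (Or.inl (ends_mixed hp hq hx hz hy hxz' hxy'))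
  · exact Or.inr (Or.inr (ends_mixed hq hp hy hz hx cyz (Setoid.symm' _ cxy)))
  · exact Or.inr (Or.inr (ends_mixed hp hq hy hz hx hyz' (Setoid.symm' _ hxy')))
  · exact Or.inr (Or.inl (ends_mixed hq hp hx hz hy cxz cxy))
  · exact Or.inl (ends_mixed hq hp hx hy hz cxy cxz)
  · exact ends_same hq hp hx hy hz cxy cxz

theorem numLoops_add_numStrings {X Y Z : Type*} [Finite X] [Finite Y] [Finite Z]
    (r : Setoid (X ⊕ Y)) (s : Setoid (Y ⊕ Z)) :
    numLoops r s + numStrings r s = Nat.card {c // IsRemoved r s c} := by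
  classical
  rw [add_comm, ← Nat.card_congr (Equiv.sumCompl
    fun c : {c // IsRemoved r s c} => HasEnd r s c.1), Nat.card_sum]
  congr 1
  · exact Nat.card_congr (Equiv.subtypeSubtypeEquivSubtypeInter _ _).symm
  · exact Nat.card_congr (Equiv.subtypeSubtypeEquivSubtypeInter _ fun c => ¬ HasEnd r s c).symm

/-- The number of removed open strings in terms of the numbers of singletons. -/
theorem numStrings_eq {X Y Z : Type*} [Finite X] [Finite Y] [Finite Z]
    {r : Setoid (X ⊕ Y)} {s : Setoid (Y ⊕ Z)} (hr : IsPairing r) (hs : IsPairing s) :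
    Nat.card {x // IsSingleton r x} + Nat.card {x // IsSingleton s x} =
      2 * numStrings r s + Nat.card {x // IsSingleton (comp r s) x} := by
  classical
  have hp := isPairing_map hr (leftIncl_injective (Z := Z))
  have hq := isPairing_map hs (rightIncl_injective (X := X))
  have h1 := card_ends hp hq
  have h2 := card_blocks (isPairing_comp hr hs)
  have h3 : Nat.card {x // IsSingleton (r.map (leftIncl (Z := Z))) x} =
      Nat.card {x // IsSingleton r x} + Nat.card Z := by
    rw [← Nat.card_sum]
    refine (Nat.card_congr (Equiv.ofBijective (Sum.elim
      (fun x => ⟨leftIncl x.1, (isSingleton_map leftIncl_injective _).2 x.2⟩)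
      (fun z => ⟨Sum.inr (Sum.inr z), isSingleton_map_of_notMem leftIncl_injective
        (by simp [leftIncl])⟩)) ⟨?_, ?_⟩)).symm
    · rintro (⟨x, hx⟩ | z) (⟨y, hy⟩ | w) h
      · have := leftIncl_injective (congrArg Subtype.val h)
        dsimp at this
        simp [this]
      · have := congrArg Subtype.val h
        rcases x with x | x <;> simp [leftIncl] at this
      · have := congrArg Subtype.val h
        rcases y with y | y <;> simp [leftIncl] at this
      · have := congrArg Subtype.val h
        simpa using this
    · rintro ⟨x | y | z, h⟩
      · exact ⟨Sum.inl ⟨Sum.inl x, (isSingleton_map leftIncl_injective (Sum.inl x)).1 h⟩, rfl⟩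
      · exact ⟨Sum.inl ⟨Sum.inr y, (isSingleton_map leftIncl_injective (Sum.inr y)).1 h⟩, rfl⟩
      · exact ⟨Sum.inr z, rfl⟩
  have h4 : Nat.card {x // IsSingleton (s.map (rightIncl (X := X))) x} =
      Nat.card {x // IsSingleton s x} + Nat.card X := by
    rw [← Nat.card_sum]
    refine (Nat.card_congr (Equiv.ofBijective (Sum.elim
      (fun x => ⟨rightIncl x.1, (isSingleton_map rightIncl_injective _).2 x.2⟩)
      (fun z => ⟨Sum.inl z, isSingleton_map_of_notMem rightIncl_injective
        (by simp [rightIncl])⟩)) ⟨?_, ?_⟩)).symm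
    · rintro (⟨x, hx⟩ | z) (⟨y, hy⟩ | w) h
      · have := rightIncl_injective (congrArg Subtype.val h)
        dsimp at this
        simp [this]
      · have := congrArg Subtype.val h
        simp [rightIncl] at this
      · have := congrArg Subtype.val h
        simp [rightIncl] at this
      · have := congrArg Subtype.val h
        simpa using this
    · rintro ⟨x | y, h⟩
      · exact ⟨Sum.inr x, rfl⟩
      · exact ⟨Sum.inl ⟨y, (isSingleton_map rightIncl_injective y).1 h⟩, rfl⟩
  have h5 : Nat.card {c : Quotient (r.map leftIncl ⊔ s.map rightIncl) //
      ∃ x, Quotient.mk _ x = c ∧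
        (IsSingleton (r.map leftIncl) x ∨ IsSingleton (s.map rightIncl) x)} =
      numStrings r s + Nat.card (Quotient (comp r s)) := by
    unfold comp
    rw [Nat.card_congr (Setoid.comapQuotientEquiv outerIncl (juxtapose r s)), numStrings]
    rw [← Nat.card_congr (Equiv.sumCompl fun c : {c : Quotient (r.map leftIncl ⊔ s.map rightIncl) //
      ∃ x, Quotient.mk _ x = c ∧
        (IsSingleton (r.map leftIncl) x ∨ IsSingleton (s.map rightIncl) x)} =>
          IsRemoved r s c.1), Nat.card_sum]
    congr 1
    · refine Nat.card_congr ((Equiv.subtypeSubtypeEquivSubtypeInter _ _).trans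
        (Equiv.subtypeEquivRight fun c => ?_))
      rw [and_comm]
      refine and_congr_right fun hc => ?_
      constructor
      · rintro ⟨x | y | z, hx, h⟩
        · exact absurd hx (hc (Sum.inl x))
        · refine ⟨y, hx, ?_⟩
          exact h.imp (isSingleton_map leftIncl_injective (Sum.inr y)).1
            (isSingleton_map rightIncl_injective (Sum.inl y)).1
        · exact absurd hx (hc (Sum.inr z))
      · rintro ⟨y, hy, h⟩
        exact ⟨midIncl y, hy, h.imp (isSingleton_map leftIncl_injective (Sum.inr y)).2
            (isSingleton_map rightIncl_injective (Sum.inl y)).2⟩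
    · refine Nat.card_congr ((Equiv.subtypeSubtypeEquivSubtypeInter _
        fun c => ¬ IsRemoved r s c).trans (Equiv.subtypeEquivRight fun c => ?_))
      simp only [IsRemoved, ne_eq, not_forall, not_not]
      constructor
      · rintro ⟨-, x, hx⟩
        exact ⟨x, hx⟩
      · rintro ⟨x, hx⟩
        exact ⟨⟨outerIncl x, hx, outer_isEnd r s x⟩, x, hx⟩
  rw [Nat.card_sum] at h2
  rw [h3, h4, h5] at h1
  omega

/-! ### Associativity -/

theorem removed_add {X Y Z : Type*} [Finite X] [Finite Y] [Finite Z]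
    (r : Setoid (X ⊕ Y)) (s : Setoid (Y ⊕ Z)) :
    Nat.card (Quotient (juxtapose r s)) =
      Nat.card {c // IsRemoved r s c} + Nat.card (Quotient (comp r s)) :=
  card_quotient _ _

/-- The juxtaposition of three diagrams. -/
def juxtapose₃ {X Y Z W : Type*} (r : Setoid (X ⊕ Y)) (s : Setoid (Y ⊕ Z)) (t : Setoid (Z ⊕ W)) :
    Setoid (X ⊕ (Y ⊕ (Z ⊕ W))) :=
  (juxtapose r s).map (Sum.map id (Sum.map id Sum.inl)) ⊔ t.map (Sum.inr ∘ Sum.inr)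

theorem juxtapose₃_eq {X Y Z W : Type*} (r : Setoid (X ⊕ Y)) (s : Setoid (Y ⊕ Z))
    (t : Setoid (Z ⊕ W)) :
    juxtapose₃ r s t = (juxtapose s t).map Sum.inr ⊔ r.map leftIncl := by
  rw [juxtapose₃, juxtapose, juxtapose, map_sup, map_sup, map_map, map_map, map_map, map_map]
  have e1 : (Sum.map id (Sum.map id Sum.inl) : X ⊕ (Y ⊕ Z) → X ⊕ (Y ⊕ (Z ⊕ W))) ∘ leftIncl =
      leftIncl := by
    funext x; rcases x with x | x <;> rfl
  have e2 : (Sum.map id (Sum.map id Sum.inl) : X ⊕ (Y ⊕ Z) → X ⊕ (Y ⊕ (Z ⊕ W))) ∘ rightIncl =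
      Sum.inr ∘ leftIncl := by
    funext x; rcases x with x | x <;> rfl
  have e3 : (Sum.inr ∘ Sum.inr : Z ⊕ W → X ⊕ (Y ⊕ (Z ⊕ W))) = Sum.inr ∘ rightIncl := rfl
  rw [e1, e2, e3, sup_assoc, sup_comm]

/-- Restriction of a pushed forward partition along a cartesian square of injections. -/
theorem comap_map {P U V W : Type*} (s : Setoid U) (f : U → V) (hf : f.Injective) (e : W → V)
    (he : e.Injective) (e' : P → W) (f' : P → U) (hc : ∀ x, e (e' x) = f (f' x))
    (hs : ∀ w u, e w = f u → ∃ x, e' x = w ∧ f' x = u) :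
    (s.map f).comap e = (s.comap f').map e' := by
  apply le_antisymm
  · intro a b h
    rcases (map_iff hf).1 h with h | ⟨u, v, hu, hv, h⟩
    · cases he h
      exact Setoid.refl' _ _
    · obtain ⟨x, rfl, rfl⟩ := hs _ _ hu.symm
      obtain ⟨y, rfl, rfl⟩ := hs _ _ hv.symm
      exact map_rel h
  · rw [map_le]
    intro x y h
    have h' : s.map f (f (f' x)) (f (f' y)) := map_rel h
    rw [← hc, ← hc] at h'
    exact h'

theorem assoc_left {X Y Z W : Type*} (r : Setoid (X ⊕ Y)) (s : Setoid (Y ⊕ Z))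
    (t : Setoid (Z ⊕ W)) :
    (juxtapose₃ r s t).comap (Sum.map id Sum.inr) = juxtapose (comp r s) t := by
  have hi : (Sum.map id (Sum.map id Sum.inl) : X ⊕ (Y ⊕ Z) → X ⊕ (Y ⊕ (Z ⊕ W))).Injective :=
    Function.Injective.sumMap Function.injective_id
      (Function.Injective.sumMap Function.injective_id Sum.inl_injective)
  have hj : (Sum.inr ∘ Sum.inr : Z ⊕ W → X ⊕ (Y ⊕ (Z ⊕ W))).Injective :=
    Sum.inr_injective.comp Sum.inr_injective
  have he : (Sum.map id Sum.inr : X ⊕ (Z ⊕ W) → X ⊕ (Y ⊕ (Z ⊕ W))).Injective :=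
    Function.Injective.sumMap Function.injective_id Sum.inr_injective
  rw [juxtapose₃, comap_sup, juxtapose, comp]
  · congr 1
    · refine comap_map _ _ hi _ he _ _ ?_ ?_
      · rintro (x | x) <;> rfl
      · rintro (w | w | w) (u | u | u) h <;>
          simp_all [leftIncl, outerIncl]
    · refine comap_map t _ hj _ he rightIncl id ?_ ?_
      · intro x; rfl
      · rintro (w | w) u h <;> simp_all [rightIncl]
  · intro x y h
    rcases (map_iff hj).1 h with h | ⟨a, b, rfl, rfl, -⟩
    · exact Or.inl h
    · exact Or.inr ⟨⟨Sum.inr a, rfl⟩, ⟨Sum.inr b, rfl⟩⟩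

theorem assoc_right {X Y Z W : Type*} (r : Setoid (X ⊕ Y)) (s : Setoid (Y ⊕ Z))
    (t : Setoid (Z ⊕ W)) :
    (juxtapose₃ r s t).comap (Sum.map id (Sum.map id Sum.inr)) = juxtapose r (comp s t) := by
  have he : (Sum.map id (Sum.map id Sum.inr) : X ⊕ (Y ⊕ W) → X ⊕ (Y ⊕ (Z ⊕ W))).Injective :=
    Function.Injective.sumMap Function.injective_id
      (Function.Injective.sumMap Function.injective_id Sum.inr_injective)
  rw [juxtapose₃_eq, comap_sup, juxtapose, comp, sup_comm]
  · congr 1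
    · refine comap_map r _ leftIncl_injective _ he leftIncl id ?_ ?_
      · rintro (x | x) <;> rfl
      · rintro (w | w | w) (u | u) h <;> simp_all [leftIncl]
    · refine comap_map _ _ Sum.inr_injective _ he _ _ ?_ ?_
      · rintro (x | x) <;> rfl
      · rintro (w | w | w) (u | u | u) h <;> simp_all [rightIncl, outerIncl]
  · intro x y h
    rcases (map_iff leftIncl_injective).1 h with h | ⟨a, b, rfl, rfl, -⟩
    · exact Or.inl h
    · have : ∀ a : X ⊕ Y, (leftIncl a : X ⊕ (Y ⊕ (Z ⊕ W))) ∈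
          Set.range (Sum.map id (Sum.map id Sum.inr) : X ⊕ (Y ⊕ W) → _) := by
        rintro (a | a)
        · exact ⟨Sum.inl a, rfl⟩
        · exact ⟨Sum.inr (Sum.inl a), rfl⟩
      exact Or.inr ⟨this a, this b⟩

theorem comp_assoc {X Y Z W : Type*} (r : Setoid (X ⊕ Y)) (s : Setoid (Y ⊕ Z))
    (t : Setoid (Z ⊕ W)) : comp (comp r s) t = comp r (comp s t) := by
  rw [comp, ← assoc_left, comp, ← assoc_right]
  ext x y
  rcases x with x | x <;> rcases y with y | y <;> rfl

theorem removed_assoc {X Y Z W : Type*} [Finite X] [Finite Y] [Finite Z] [Finite W]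
    (r : Setoid (X ⊕ Y)) (s : Setoid (Y ⊕ Z)) (t : Setoid (Z ⊕ W)) :
    Nat.card {c // IsRemoved r s c} + Nat.card {c // IsRemoved (comp r s) t c} =
      Nat.card {c // IsRemoved s t c} + Nat.card {c // IsRemoved r (comp s t) c} := by
  have h1 := card_quotient (juxtapose₃ r s t) (Sum.map id Sum.inr)
  have h2 := card_quotient (juxtapose₃ r s t) (Sum.map id (Sum.map id Sum.inr))
  rw [assoc_left, removed_add] at h1
  rw [assoc_right, removed_add, ← comp_assoc] at h2
  have h3 : Nat.card {c // IsRemoved r s c} = Nat.card {c : Quotient (juxtapose₃ r s t) //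
      ∀ w, Quotient.mk _ (Sum.map id Sum.inr w) ≠ c} := by
    refine card_inner (juxtapose r s) _ _ ?_ outerIncl _ ?_ ?_ ?_
    · exact Function.Injective.sumMap Function.injective_id
        (Function.Injective.sumMap Function.injective_id Sum.inl_injective)
    · intro x y h
      rcases (map_iff (Sum.inr_injective.comp Sum.inr_injective)).1 h with h | ⟨a, b, rfl, rfl, -⟩
      · exact Or.inl h
      · exact Or.inr ⟨⟨Sum.inr a, rfl⟩, ⟨Sum.inr b, rfl⟩⟩
    · rintro (x | x | x | x) <;> simp
    · rintro (x | x | x) <;> simp [outerIncl]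
  have h4 : Nat.card {c // IsRemoved s t c} = Nat.card {c : Quotient (juxtapose₃ r s t) //
      ∀ w, Quotient.mk _ (Sum.map id (Sum.map id Sum.inr) w) ≠ c} := by
    rw [juxtapose₃_eq]
    refine card_inner (juxtapose s t) _ _ Sum.inr_injective outerIncl _ ?_ ?_ ?_
    · intro x y h
      rcases (map_iff leftIncl_injective).1 h with h | ⟨a, b, rfl, rfl, -⟩
      · exact Or.inl h
      · right
        constructor
        · rcases a with a | a <;> simp [leftIncl]
        · rcases b with b | b <;> simp [leftIncl]
    · rintro (x | x | x | x) <;> simp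
    · rintro (x | x | x) <;> simp [outerIncl]
  omega

theorem numStrings_assoc {X Y Z W : Type*} [Finite X] [Finite Y] [Finite Z] [Finite W]
    {r : Setoid (X ⊕ Y)} {s : Setoid (Y ⊕ Z)} {t : Setoid (Z ⊕ W)}
    (hr : IsPairing r) (hs : IsPairing s) (ht : IsPairing t) :
    numStrings r s + numStrings (comp r s) t = numStrings s t + numStrings r (comp s t) := by
  have h1 := numStrings_eq hr hs
  have h2 := numStrings_eq (isPairing_comp hr hs) ht
  have h3 := numStrings_eq hs ht
  have h4 := numStrings_eq hr (isPairing_comp hs ht)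
  rw [comp_assoc] at h2
  omega

theorem numLoops_assoc {X Y Z W : Type*} [Finite X] [Finite Y] [Finite Z] [Finite W]
    {r : Setoid (X ⊕ Y)} {s : Setoid (Y ⊕ Z)} {t : Setoid (Z ⊕ W)}
    (hr : IsPairing r) (hs : IsPairing s) (ht : IsPairing t) :
    numLoops r s + numLoops (comp r s) t = numLoops s t + numLoops r (comp s t) := by
  have h1 := numStrings_assoc hr hs ht
  have h2 := removed_assoc r s t
  simp only [← numLoops_add_numStrings] at h2
  omega

/-! ### The identity partition -/

/-- The partition of `X ⊔ X'` into the pairs `{x, x'}`. -/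
def idPartition (X : Type*) : Setoid (X ⊕ X) := Setoid.ker (Sum.elim id id)

theorem isPairing_id (X : Type*) : IsPairing (idPartition X) := by
  rintro (x | x) (y | y) (z | z) (h : x = y) (h' : x = z) <;> subst h <;> subst h' <;> simp

theorem juxtapose_id_left {X Y : Type*} (r : Setoid (X ⊕ Y)) :
    juxtapose (idPartition X) r = r.comap (Sum.elim Sum.inl id) := by
  have hL : ∀ v : X ⊕ (X ⊕ Y), juxtapose (idPartition X) r v (Sum.inr (Sum.elim Sum.inl id v)) := by
    rintro (x | v)
    · refine (le_sup_left : (idPartition X).map leftIncl ≤ _) ?_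
      exact map_rel (f := leftIncl) (x := Sum.inl x) (y := Sum.inr x)
        (show idPartition X (Sum.inl x) (Sum.inr x) from rfl)
    · exact Setoid.refl' _ _
  apply le_antisymm
  · refine sup_le ?_ ?_
    · rw [map_le]
      rintro (x | x) (y | y) (h : x = y) <;> subst h <;> exact r.refl' _
    · rw [map_le]
      exact fun x y h => h
  · intro v w h
    exact Setoid.trans' _ (hL v) (Setoid.trans' _
      ((le_sup_right : r.map rightIncl ≤ juxtapose (idPartition X) r) (map_rel h))
      (Setoid.symm' _ (hL w)))

theorem juxtapose_id_right {X Y : Type*} (r : Setoid (X ⊕ Y)) :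
    juxtapose r (idPartition Y) = r.comap (Sum.map id (Sum.elim id id)) := by
  have hL : ∀ v : X ⊕ (Y ⊕ Y),
      juxtapose r (idPartition Y) v (leftIncl (Sum.map id (Sum.elim id id) v)) := by
    rintro (x | y | y)
    · exact Setoid.refl' _ _
    · exact Setoid.refl' _ _
    · refine (le_sup_right : (idPartition Y).map rightIncl ≤ _) ?_
      exact map_rel (f := rightIncl) (x := Sum.inr y) (y := Sum.inl y)
        (show idPartition Y (Sum.inr y) (Sum.inl y) from rfl)
  apply le_antisymm
  · refine sup_le ?_ ?_
    · rw [map_le]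
      rintro (x | x) (y | y) h <;> exact h
    · rw [map_le]
      rintro (x | x) (y | y) (h : x = y) <;> subst h <;> exact r.refl' _
  · intro v w h
    exact Setoid.trans' _ (hL v) (Setoid.trans' _
      ((le_sup_left : r.map leftIncl ≤ juxtapose r (idPartition Y)) (map_rel h))
      (Setoid.symm' _ (hL w)))

theorem id_comp {X Y : Type*} (r : Setoid (X ⊕ Y)) : comp (idPartition X) r = r := by
  rw [comp, juxtapose_id_left, ← Setoid.comap_comp]
  convert Setoid.comap_id r
  funext x
  rcases x with x | x <;> rfl

theorem comp_id {X Y : Type*} (r : Setoid (X ⊕ Y)) : comp r (idPartition Y) = r := by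
  rw [comp, juxtapose_id_right, ← Setoid.comap_comp]
  convert Setoid.comap_id r
  funext x
  rcases x with x | x <;> rfl

theorem not_isRemoved_id_left {X Y : Type*} (r : Setoid (X ⊕ Y)) (c) :
    ¬ IsRemoved (idPartition X) r c := by
  induction c using Quotient.inductionOn with
  | h v =>
    intro h
    rcases v with x | x | y
    · exact h (Sum.inl x) rfl
    · refine h (Sum.inl x) (Quotient.sound ?_)
      show juxtapose (idPartition X) r _ _
      rw [juxtapose_id_left]
      exact r.refl' _
    · exact h (Sum.inr y) rfl

theorem not_isRemoved_id_right {X Y : Type*} (r : Setoid (X ⊕ Y)) (c) :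
    ¬ IsRemoved r (idPartition Y) c := by
  induction c using Quotient.inductionOn with
  | h v =>
    intro h
    rcases v with x | y | y
    · exact h (Sum.inl x) rfl
    · refine h (Sum.inr y) (Quotient.sound ?_)
      show juxtapose r (idPartition Y) _ _
      rw [juxtapose_id_right]
      exact r.refl' _
    · exact h (Sum.inr y) rfl

/-! ### The partial Brauer algebra -/

/-- Partial Brauer partitions of `{1, …, n} ⊔ {1', …, n'}`: partitions into pairs and singletons.
The left summand holds the vertices `i`, the right summand the vertices `i'`. -/
structure Diagram (n : ℕ) where
  /-- The underlying set partition. -/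
  partition : Setoid (Fin n ⊕ Fin n)
  /-- Its blocks have at most two elements. -/
  isPairing : IsPairing partition

/-- The straightened juxtaposition `d ∘ d'`. -/
def Diagram.comp {n : ℕ} (d d' : Diagram n) : Diagram n :=
  ⟨PartialBrauer.comp d.partition d'.partition, isPairing_comp d.isPairing d'.isPairing⟩

/-- The diagram with blocks `{i, i'}`. -/
def Diagram.id (n : ℕ) : Diagram n :=
  ⟨idPartition (Fin n), isPairing_id (Fin n)⟩

/-- The straightening factor: `δ` for each removed loop, `δ'` for each removed open string. -/
noncomputable def factor {k : Type*} [CommRing k] (δ δ' : k) {n : ℕ} (d d' : Diagram n) : k :=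
  δ ^ numLoops d.partition d'.partition * δ' ^ numStrings d.partition d'.partition

theorem factor_assoc {k : Type*} [CommRing k] (δ δ' : k) {n : ℕ} (a b c : Diagram n) :
    factor δ δ' a b * factor δ δ' (a.comp b) c = factor δ δ' b c * factor δ δ' a (b.comp c) := by
  have h1 := numLoops_assoc a.isPairing b.isPairing c.isPairing
  have h2 := numStrings_assoc a.isPairing b.isPairing c.isPairing
  unfold factor
  calc _ = δ ^ (numLoops a.partition b.partition + numLoops (a.comp b).partition c.partition) *
        δ' ^ (numStrings a.partition b.partition +
          numStrings (a.comp b).partition c.partition) := by ring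
    _ = δ ^ (numLoops b.partition c.partition + numLoops a.partition (b.comp c).partition) *
        δ' ^ (numStrings b.partition c.partition +
          numStrings a.partition (b.comp c).partition) := by
          congr 2
    _ = _ := by ring

theorem factor_id_left {k : Type*} [CommRing k] (δ δ' : k) {n : ℕ} (d : Diagram n) :
    factor δ δ' (Diagram.id n) d = 1 := by
  have h1 : numLoops (Diagram.id n).partition d.partition = 0 := by
    have : IsEmpty {c // IsRemoved (Diagram.id n).partition d.partition c ∧
        ¬ HasEnd (Diagram.id n).partition d.partition c} :=
      ⟨fun c => not_isRemoved_id_left _ _ c.2.1⟩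
    exact Nat.card_of_isEmpty
  have h2 : numStrings (Diagram.id n).partition d.partition = 0 := by
    have : IsEmpty {c // IsRemoved (Diagram.id n).partition d.partition c ∧
        HasEnd (Diagram.id n).partition d.partition c} :=
      ⟨fun c => not_isRemoved_id_left _ _ c.2.1⟩
    exact Nat.card_of_isEmpty
  simp [factor, h1, h2]

theorem factor_id_right {k : Type*} [CommRing k] (δ δ' : k) {n : ℕ} (d : Diagram n) :
    factor δ δ' d (Diagram.id n) = 1 := by
  have h1 : numLoops d.partition (Diagram.id n).partition = 0 := by
    have : IsEmpty {c // IsRemoved d.partition (Diagram.id n).partition c ∧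
        ¬ HasEnd d.partition (Diagram.id n).partition c} :=
      ⟨fun c => not_isRemoved_id_right _ _ c.2.1⟩
    exact Nat.card_of_isEmpty
  have h2 : numStrings d.partition (Diagram.id n).partition = 0 := by
    have : IsEmpty {c // IsRemoved d.partition (Diagram.id n).partition c ∧
        HasEnd d.partition (Diagram.id n).partition c} :=
      ⟨fun c => not_isRemoved_id_right _ _ c.2.1⟩
    exact Nat.card_of_isEmpty
  simp [factor, h1, h2]

end PartialBrauer

/-- The partial Brauer algebra `R_n(δ, δ')` over `k`: the free `k`-module on the partial Brauer
diagrams, with product `d * d' = δ ^ (loops) δ' ^ (open strings) (d ∘ d')`. -/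
def PartialBrauerAlgebra (k : Type*) [CommRing k] (n : ℕ) (_δ _δ' : k) : Type _ :=
  PartialBrauer.Diagram n →₀ k

namespace PartialBrauerAlgebra

noncomputable instance instAddCommGroup (k : Type*) [CommRing k] (n : ℕ) (δ δ' : k) :
    AddCommGroup (PartialBrauerAlgebra k n δ δ') :=
  inferInstanceAs (AddCommGroup (PartialBrauer.Diagram n →₀ k))

noncomputable instance instModule (k : Type*) [CommRing k] (n : ℕ) (δ δ' : k) :
    Module k (PartialBrauerAlgebra k n δ δ') :=
  inferInstanceAs (Module k (PartialBrauer.Diagram n →₀ k))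

/-- The basis of diagrams. -/
noncomputable def basis (k : Type*) [CommRing k] (n : ℕ) (δ δ' : k) :
    Module.Basis (PartialBrauer.Diagram n) k (PartialBrauerAlgebra k n δ δ') :=
  Module.Basis.ofRepr (LinearEquiv.refl k (PartialBrauer.Diagram n →₀ k))

/-- The bilinear extension of the product of diagrams. -/
noncomputable def mulLin (k : Type*) [CommRing k] (n : ℕ) (δ δ' : k) :
    PartialBrauerAlgebra k n δ δ' →ₗ[k] PartialBrauerAlgebra k n δ δ' →ₗ[k]
      PartialBrauerAlgebra k n δ δ' :=
  (basis k n δ δ').constr k fun d => (basis k n δ δ').constr k fun d' =>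
    PartialBrauer.factor δ δ' d d' • basis k n δ δ' (d.comp d')

theorem mulLin_basis {k : Type*} [CommRing k] {n : ℕ} (δ δ' : k) (d d' : PartialBrauer.Diagram n) :
    mulLin k n δ δ' (basis k n δ δ' d) (basis k n δ δ' d') =
      PartialBrauer.factor δ δ' d d' • basis k n δ δ' (d.comp d') := by
  simp [mulLin]

theorem mulLin_assoc {k : Type*} [CommRing k] {n : ℕ} (δ δ' : k)
    (x y z : PartialBrauerAlgebra k n δ δ') :
    mulLin k n δ δ' (mulLin k n δ δ' x y) z = mulLin k n δ δ' x (mulLin k n δ δ' y z) := by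
  set b := basis k n δ δ' with hb
  set m := mulLin k n δ δ' with hm
  have h1 : ∀ d e, m (m (b d) (b e)) = (m (b d)).comp (m (b e)) := by
    intro d e
    refine b.ext fun f => ?_
    have hc : (d.comp e).comp f = d.comp (e.comp f) := by
      simp only [PartialBrauer.Diagram.comp, PartialBrauer.comp_assoc]
    simp only [LinearMap.comp_apply, hm, hb, mulLin_basis, map_smul, LinearMap.smul_apply,
      smul_smul, hc, PartialBrauer.factor_assoc]
  have h2 : ∀ d, (m.flip z).comp (m (b d)) = (m (b d)).comp (m.flip z) := by
    intro d
    refine b.ext fun e => ?_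
    exact LinearMap.congr_fun (h1 d e) z
  have h3 : (m.flip z).comp (m.flip y) = m.flip (m y z) := by
    refine b.ext fun d => ?_
    exact LinearMap.congr_fun (h2 d) y
  exact LinearMap.congr_fun h3 x

theorem mulLin_one_left {k : Type*} [CommRing k] {n : ℕ} (δ δ' : k)
    (x : PartialBrauerAlgebra k n δ δ') :
    mulLin k n δ δ' (basis k n δ δ' (PartialBrauer.Diagram.id n)) x = x := by
  have h : mulLin k n δ δ' (basis k n δ δ' (PartialBrauer.Diagram.id n)) = LinearMap.id := by
    refine (basis k n δ δ').ext fun d => ?_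
    have hc : (PartialBrauer.Diagram.id n).comp d = d := by
      simp only [PartialBrauer.Diagram.comp, PartialBrauer.Diagram.id, PartialBrauer.id_comp]
    rw [mulLin_basis, PartialBrauer.factor_id_left, one_smul, hc, LinearMap.id_apply]
  rw [h, LinearMap.id_apply]

theorem mulLin_one_right {k : Type*} [CommRing k] {n : ℕ} (δ δ' : k)
    (x : PartialBrauerAlgebra k n δ δ') :
    mulLin k n δ δ' x (basis k n δ δ' (PartialBrauer.Diagram.id n)) = x := by
  have h : (mulLin k n δ δ').flip (basis k n δ δ' (PartialBrauer.Diagram.id n)) =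
      LinearMap.id := by
    refine (basis k n δ δ').ext fun d => ?_
    have hc : d.comp (PartialBrauer.Diagram.id n) = d := by
      simp only [PartialBrauer.Diagram.comp, PartialBrauer.Diagram.id, PartialBrauer.comp_id]
    rw [LinearMap.flip_apply, mulLin_basis, PartialBrauer.factor_id_right, one_smul, hc,
      LinearMap.id_apply]
  exact LinearMap.congr_fun h x

noncomputable instance instRing (k : Type*) [CommRing k] (n : ℕ) (δ δ' : k) :
    Ring (PartialBrauerAlgebra k n δ δ') :=
  { instAddCommGroup k n δ δ' with
    mul := fun x y => mulLin k n δ δ' x y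
    one := basis k n δ δ' (PartialBrauer.Diagram.id n)
    left_distrib := fun x y z => map_add (mulLin k n δ δ' x) y z
    right_distrib := fun x y z => LinearMap.map_add₂ (mulLin k n δ δ') x y z
    zero_mul := fun x => LinearMap.map_zero₂ (mulLin k n δ δ') x
    mul_zero := fun x => map_zero (mulLin k n δ δ' x)
    mul_assoc := mulLin_assoc δ δ'
    one_mul := mulLin_one_left δ δ'
    mul_one := mulLin_one_right δ δ' }

noncomputable instance instAlgebra (k : Type*) [CommRing k] (n : ℕ) (δ δ' : k) :
    Algebra k (PartialBrauerAlgebra k n δ δ') :=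
  Algebra.ofModule (fun a x y => LinearMap.map_smul₂ (mulLin k n δ δ') a x y)
    (fun a x y => map_smul (mulLin k n δ δ' x) a y)

end PartialBrauerAlgebra

/-! The radical of a finite-dimensional algebra lies in the radical of the regular trace form `(a,
b) ↦ tr(L_{ab})`, so a nonzero Gram determinant forces semisimplicity. In the basis of diagrams this
determinant is that of `traceMatrix`. It remains to show that it vanishes for only finitely many
`δ`, independently of `δ' ≠ 0`.

Dependence on `δ'`: by `numStrings_eq`, the numbers of singletons of `d` and `e` add up to that of
`d ∘ e` plus twice the number of removed open strings. Rescaling each diagram by a power of `ε`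
therefore turns the parameter `ε ^ 2` into `1`, and the determinant changes by a nonzero factor
(`det_traceMatrix_sq`). Every nonzero complex `δ'` is a square.

Dependence on `δ`: at `δ' = 1` the determinant is an integer polynomial in `δ`, so one real point
where it is nonzero suffices. Take `δ = δ' = t ^ 2` with `t` large. When the parameters agree, only
the total number of removed components matters, and the form `δ ^ #(blocks of d ⊔ e)` makes left
multiplication by the reflection of `d` the adjoint of left multiplication by `d`
(`closureForm_mul_mulMatrix`). For large `t` this form is dominated by its diagonal, hence positive
definite (`posDef_closureForm`). A space of real matrices closed under adjoints for a positive
definite form has a nondegenerate trace form, because `tr(x x*) = 0` implies `x = 0`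
(`Matrix.det_trace_mul_ne_zero`). -/

/-! ### Semisimplicity from the regular trace form. -/

/-- A finite-dimensional algebra whose regular trace form is nondegenerate is semisimple. -/
theorem isSemisimpleRing_of_det_trace_ne_zero {k A ι : Type*} [Field k] [Ring A] [Algebra k A]
    [Fintype ι] [DecidableEq ι] (b : Module.Basis ι k A)
    (h : (Matrix.of fun i j => LinearMap.trace k A (LinearMap.mulLeft k (b i * b j))).det ≠ 0) :
    IsSemisimpleRing A := by
  have : Module.Finite k A := Module.Finite.of_basis b
  have : IsArtinianRing A := IsArtinianRing.of_finite k A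
  rw [IsArtinianRing.isSemisimpleRing_iff_jacobson, eq_bot_iff]
  intro x hx
  -- The radical of an Artinian ring is a nilpotent two-sided ideal, so `x * y` is nilpotent and so
  -- is left multiplication by it.
  have hnil : ∀ y, LinearMap.trace k A (LinearMap.mulLeft k (x * y)) = 0 := by
    intro y
    have hxy : x * y ∈ Ring.jacobson A := Ideal.mul_mem_right _ _ hx
    obtain ⟨m, hm⟩ := IsArtinianRing.isNilpotent_jacobson_bot (R := A)
    rw [Ideal.jacobson_bot] at hm
    have h0 : (x * y) ^ m = 0 := by
      have := Ideal.pow_mem_pow hxy m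
      rwa [hm] at this
    exact (LinearMap.isNilpotent_trace_of_isNilpotent
      (IsNilpotent.map ⟨m, h0⟩ (Algebra.lmul k A))).eq_zero
  by_contra hne
  -- A nonzero `x` in the radical has coordinates that form a nonzero vector in the left kernel of
  -- the Gram matrix.
  refine h (Matrix.exists_vecMul_eq_zero_iff.1 ⟨fun i => b.repr x i, ?_, ?_⟩)
  · intro h0
    exact hne (b.repr.map_eq_zero_iff.1 (Finsupp.ext fun i => congrFun h0 i))
  · funext j
    let φ : A →ₗ[k] k := LinearMap.trace k A ∘ₗ (LinearMap.mul k A)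
    have h1 : φ (x * b j) = 0 := hnil (b j)
    rw [← b.sum_repr x, Finset.sum_mul, map_sum] at h1
    simp only [Algebra.smul_mul_assoc, map_smul, smul_eq_mul] at h1
    exact h1

/-! ### Real matrices: adjoints and positive definiteness. -/

namespace Matrix

open scoped MatrixOrder Matrix.Norms.L2Operator in
/-- If a linearly independent family of matrices is closed under taking adjoints with respect to a
positive definite form, then the trace form on its span is nondegenerate. -/
theorem det_trace_mul_ne_zero {ι κ : Type*} [Fintype ι] [DecidableEq ι] [Fintype κ] [DecidableEq κ]
    {G : Matrix κ κ ℝ} (hG : G.PosDef) (M : ι → Matrix κ κ ℝ) (hM : LinearIndependent ℝ M)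
    (s : ι → ι) (hs : ∀ i, G * M i = (M (s i))ᵀ * G) :
    (Matrix.of fun i j => (M i * M j).trace).det ≠ 0 := by
  intro h0
  obtain ⟨v, hv, h⟩ := Matrix.exists_vecMul_eq_zero_iff.2 h0
  -- Factoring the form as `Bᵀ * B` with `B` invertible lets conjugation by `B` turn adjoints for
  -- the form into ordinary transposes.
  obtain ⟨B, hB, rfl⟩ :=
    CStarAlgebra.isStrictlyPositive_iff_eq_star_mul_self.mp hG.isStrictlyPositive
  lift B to (Matrix κ κ ℝ)ˣ using hB
  rw [star_eq_conjTranspose, conjTranspose_eq_transpose_of_trivial] at hs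
  set x := ∑ i, v i • M i with hx
  set x' := ∑ i, v i • M (s i) with hx'
  have hxx' : (B : Matrix κ κ ℝ)ᵀ * B * x = x'ᵀ * ((B : Matrix κ κ ℝ)ᵀ * B) := by
    simp [hx, hx', Matrix.mul_sum, Matrix.sum_mul, hs, Matrix.transpose_sum]
  -- The kernel vector makes `x` orthogonal to every `M j` under the trace form, hence to `x'`,
  -- which is a combination of the `M j` and is the adjoint of `x`.
  have htr : (x * x').trace = 0 := by
    have : ∀ j, ∑ i, v i * (M i * M j).trace = 0 := fun j => by
      simpa [Matrix.vecMul, dotProduct] using congrFun h j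
    simp only [hx, hx', Matrix.mul_sum, Matrix.sum_mul, Matrix.trace_sum, Matrix.smul_mul,
      Matrix.mul_smul, Matrix.trace_smul, smul_eq_mul]
    simp [this]
  have hBt : ((B⁻¹ : (Matrix κ κ ℝ)ˣ) : Matrix κ κ ℝ)ᵀ * (B : Matrix κ κ ℝ)ᵀ = 1 := by
    rw [← Matrix.transpose_mul]; simp
  set C : Matrix κ κ ℝ := ((B⁻¹ : (Matrix κ κ ℝ)ˣ) : Matrix κ κ ℝ) with hC
  have hBC : (B : Matrix κ κ ℝ) * C = 1 := by simp [hC]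
  have hCB : C * (B : Matrix κ κ ℝ) = 1 := by simp [hC]
  generalize (B : Matrix κ κ ℝ) = b at *
  have hadj : (b * x * C)ᵀ = b * x' * C := by
    have h1 : xᵀ * (bᵀ * b) = bᵀ * b * x' := by
      have := congrArg Matrix.transpose hxx'
      simpa [Matrix.transpose_mul, Matrix.mul_assoc] using this
    calc (b * x * C)ᵀ = Cᵀ * (xᵀ * (bᵀ * b)) * C := by
          simp only [Matrix.transpose_mul, Matrix.mul_assoc, hBC, Matrix.mul_one]
      _ = (Cᵀ * bᵀ) * b * x' * C := by rw [h1]; simp only [Matrix.mul_assoc]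
      _ = _ := by rw [hBt, Matrix.one_mul]
  -- With `C` the inverse of `b`, this product is the conjugate of `x * x'`, so its trace is zero;
  -- as a sum of squares of entries it forces `x = 0`.
  have hz : ((b * x * C) * (b * x * C)ᴴ).trace = 0 := by
    rw [conjTranspose_eq_transpose_of_trivial, hadj]
    have : b * x * C * (b * x' * C) = b * (x * x' * C) := by
      simp only [Matrix.mul_assoc]
      rw [← Matrix.mul_assoc C b, hCB, Matrix.one_mul]
    rw [this, Matrix.trace_mul_comm, Matrix.mul_assoc, hCB, Matrix.mul_one, htr]
  rw [trace_mul_conjTranspose_self_eq_zero_iff] at hz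
  have hx0 : x = 0 := by
    calc x = (C * b) * x * (C * b) := by rw [hCB, Matrix.one_mul, Matrix.mul_one]
      _ = C * (b * x * C) * b := by simp only [Matrix.mul_assoc]
      _ = 0 := by rw [hz, Matrix.mul_zero, Matrix.zero_mul]
  exact hv (funext (Fintype.linearIndependent_iff.1 hM v hx0))

/-- A symmetric matrix whose off-diagonal entries are small compared with the geometric means of
the diagonal ones is positive definite. -/
theorem posDef_of_offDiag_small {ι : Type*} [Fintype ι] {G : Matrix ι ι ℝ} (hG : G.IsSymm)
    (w : ι → ℝ) (hw : ∀ i, 0 < w i) (hd : ∀ i, G i i = w i ^ 2) {t : ℝ}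
    (ht : (Fintype.card ι : ℝ) < t) (ho : ∀ i j, i ≠ j → t * |G i j| ≤ w i * w j) :
    G.PosDef := by
  classical
  have ht0 : 0 < t := lt_of_le_of_lt (Nat.cast_nonneg _) ht
  refine PosDef.of_dotProduct_mulVec_pos (by
    rw [IsHermitian, conjTranspose_eq_transpose_of_trivial]; exact hG) fun v hv => ?_
  set u : ι → ℝ := fun i => w i * v i with hu
  -- Off the diagonal this is `|u i| * |u j| ≤ (u i ^ 2 + u j ^ 2) / 2`. On the diagonal `u i ^ 2 /
  -- t` is given away so that both cases have one shape; the total loss is then `card ι / t` times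
  -- `∑ u i ^ 2`, which is why `card ι < t` is required.
  have hentry : ∀ i j, t * ((if i = j then u i ^ 2 else 0) - (u i ^ 2 + u j ^ 2) / (2 * t)) ≤
      t * (v i * (G i j * v j)) := by
    intro i j
    have e1 : t * ((if i = j then u i ^ 2 else 0) - (u i ^ 2 + u j ^ 2) / (2 * t)) =
        t * (if i = j then u i ^ 2 else 0) - (u i ^ 2 + u j ^ 2) / 2 := by
      field_simp
    rw [e1]
    by_cases hij : i = j
    · subst hij
      simp only [if_true, hd, hu]
      nlinarith [sq_nonneg (w i * v i)]
    · rw [if_neg hij, mul_zero, zero_sub]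
      have h1 : |t * (v i * (G i j * v j))| ≤ |u i| * |u j| := by
        simp only [hu, abs_mul, abs_of_pos ht0, abs_of_pos (hw _)]
        have := mul_le_mul_of_nonneg_right (ho i j hij)
          (mul_nonneg (abs_nonneg (v i)) (abs_nonneg (v j)))
        linarith
      have h2 := neg_abs_le (t * (v i * (G i j * v j)))
      nlinarith [sq_nonneg (|u i| - |u j|), sq_abs (u i), sq_abs (u j)]
  have hsum : ∑ i, ∑ j, ((if i = j then u i ^ 2 else 0) - (u i ^ 2 + u j ^ 2) / (2 * t)) ≤
      ∑ i, ∑ j, v i * (G i j * v j) :=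
    Finset.sum_le_sum fun i _ => Finset.sum_le_sum fun j _ =>
      le_of_mul_le_mul_left (hentry i j) ht0
  have hleft : ∑ i, ∑ j, ((if i = j then u i ^ 2 else 0) - (u i ^ 2 + u j ^ 2) / (2 * t)) =
      (1 - Fintype.card ι / t) * ∑ i, u i ^ 2 := by
    simp only [Finset.sum_sub_distrib, ← Finset.sum_div, Finset.sum_add_distrib,
      Finset.sum_ite_eq, Finset.mem_univ, if_true, Finset.sum_const, Finset.card_univ,
      nsmul_eq_mul, ← Finset.mul_sum]
    field_simp
    ring
  have hpos : 0 < ∑ i, u i ^ 2 := by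
    obtain ⟨i, hi⟩ := Function.ne_iff.1 hv
    exact Finset.sum_pos' (fun _ _ => sq_nonneg _)
      ⟨i, Finset.mem_univ i, sq_pos_of_ne_zero (mul_ne_zero (hw i).ne' hi)⟩
  have hc : 0 < 1 - Fintype.card ι / t := sub_pos.2 ((div_lt_one ht0).2 ht)
  have := (mul_pos hc hpos).trans_le (hleft ▸ hsum)
  simpa [dotProduct, mulVec, Finset.mul_sum] using this

end Matrix

/-! ### Block counts of joins, and reflection of partitions. -/

namespace PartialBrauer

theorem map_id {V : Type*} (r : Setoid V) : r.map id = r := by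
  refine eq_of_forall_ge_iff fun t => ?_
  rw [map_le, Setoid.comap_id]

theorem comap_map_self {V W : Type*} (r : Setoid V) {f : V → W} (hf : f.Injective) :
    (r.map f).comap f = r := by
  ext x y
  refine (map_iff hf).trans ⟨?_, fun h => Or.inr ⟨x, y, rfl, rfl, h⟩⟩
  rintro (h | ⟨a, b, ha, hb, h⟩)
  · rw [hf h]
  · rwa [← hf ha, ← hf hb]

theorem map_equiv {V W : Type*} (r : Setoid V) (e : V ≃ W) : r.map e = r.comap e.symm := by
  ext x y
  refine (map_iff e.injective).trans ⟨?_, fun h => Or.inr ⟨_, _, by simp, by simp, h⟩⟩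
  rintro (rfl | ⟨a, b, rfl, rfl, h⟩)
  · exact Setoid.refl' _ _
  · simpa [Setoid.comap_rel] using h

theorem card_quotient_map_equiv {V W : Type*} (r : Setoid V) (e : V ≃ W) :
    Nat.card (Quotient (r.map e)) = Nat.card (Quotient r) := by
  refine (Nat.card_congr (Quotient.congr e fun x y => ?_)).symm
  rw [map_equiv]
  change r x y ↔ r (e.symm (e x)) (e.symm (e y))
  rw [e.symm_apply_apply, e.symm_apply_apply]

theorem card_quotient_le {V : Type*} [Finite V] {r s : Setoid V} (h : r ≤ s) :
    Nat.card (Quotient s) ≤ Nat.card (Quotient r) :=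
  Nat.card_le_card_of_surjective (Quotient.map id h)
    (Quotient.ind fun x => ⟨Quotient.mk r x, rfl⟩)

theorem eq_of_card_quotient_eq {V : Type*} [Finite V] {r s : Setoid V} (h : r ≤ s)
    (hc : Nat.card (Quotient r) = Nat.card (Quotient s)) : r = s := by
  have hb : Function.Bijective (Quotient.map id h : Quotient r → Quotient s) :=
    Function.Surjective.bijective_of_nat_card_le
      (Quotient.ind fun x => ⟨Quotient.mk r x, rfl⟩) hc.le
  refine le_antisymm h fun x y hxy => ?_
  exact Quotient.exact (hb.1 (Quotient.sound hxy :
    Quotient.map id h (Quotient.mk r x) = Quotient.map id h (Quotient.mk r y)))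

/-- Coarsening strictly loses blocks, and for distinct partitions the join is strictly coarser than
at least one of them. The gap of one block is what makes off-diagonal entries of `closureForm`
smaller than the geometric mean of the diagonal ones by a factor of at least `t`. -/
theorem two_mul_card_sup_lt {V : Type*} [Finite V] {r s : Setoid V} (h : r ≠ s) :
    2 * Nat.card (Quotient (r ⊔ s)) < Nat.card (Quotient r) + Nat.card (Quotient s) := by
  have h1 := card_quotient_le (le_sup_left : r ≤ r ⊔ s)
  have h2 := card_quotient_le (le_sup_right : s ≤ r ⊔ s)
  by_contra hlt
  have e1 := eq_of_card_quotient_eq (le_sup_left : r ≤ r ⊔ s) (by omega)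
  have e2 := eq_of_card_quotient_eq (le_sup_right : s ≤ r ⊔ s) (by omega)
  exact h (e1.trans e2.symm)

/-- Components of the closure of the juxtaposition of `a` and `x` by a partition `y` of the outer
vertices. -/
theorem card_removed_add_card_sup {X Y Z : Type*} [Finite X] [Finite Y] [Finite Z]
    (a : Setoid (X ⊕ Y)) (x : Setoid (Y ⊕ Z)) (y : Setoid (X ⊕ Z)) :
    Nat.card {c // IsRemoved a x c} + Nat.card (Quotient (comp a x ⊔ y)) =
      Nat.card (Quotient (juxtapose a x ⊔ y.map outerIncl)) := by
  have ht : ∀ v w : X ⊕ (Y ⊕ Z), y.map outerIncl v w →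
      v = w ∨ v ∈ Set.range outerIncl ∧ w ∈ Set.range outerIncl := by
    intro v w h
    rcases (map_iff outerIncl_injective).1 h with h | ⟨a, b, rfl, rfl, -⟩
    · exact Or.inl h
    · exact Or.inr ⟨⟨a, rfl⟩, ⟨b, rfl⟩⟩
  -- Components that avoid the outer vertices are untouched by `y` and are exactly the removed ones.
  -- The others correspond to blocks of the restriction to the outer vertices, which is `comp a x ⊔
  -- y`.
  rw [card_quotient _ (outerIncl : X ⊕ Z → X ⊕ (Y ⊕ Z)), comap_sup _ _ _ ht,
    comap_map_self _ outerIncl_injective]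
  congr 1
  have := card_inner (juxtapose a x) (y.map outerIncl) id Function.injective_id outerIncl outerIncl
    ht (fun v => Or.inr ⟨v, rfl⟩) (fun u => Iff.rfl)
  rw [map_id] at this
  exact this

/-- The reflection of a partition which exchanges left and right vertices. -/
def flip {X Y : Type*} (r : Setoid (X ⊕ Y)) : Setoid (Y ⊕ X) := r.map (Equiv.sumComm X Y)

theorem isPairing_flip {X Y : Type*} {r : Setoid (X ⊕ Y)} (hr : IsPairing r) :
    IsPairing (flip r) :=
  isPairing_map hr (Equiv.sumComm X Y).injective

/-- Removing components commutes with moving the left factor to the other side. -/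
theorem card_removed_flip {X Y Z : Type*} [Finite X] [Finite Y] [Finite Z]
    (a : Setoid (X ⊕ Y)) (x : Setoid (Y ⊕ Z)) (y : Setoid (X ⊕ Z)) :
    Nat.card {c // IsRemoved a x c} + Nat.card (Quotient (y ⊔ comp a x)) =
      Nat.card {c // IsRemoved (flip a) y c} + Nat.card (Quotient (comp (flip a) y ⊔ x)) := by
  -- Both sides now count the components of one closed graph on the three vertex sets, glued from
  -- `a`, `x` and `y`; they differ only by the reordering `e` of the vertex sets.
  rw [sup_comm y, card_removed_add_card_sup, card_removed_add_card_sup]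
  let e : X ⊕ (Y ⊕ Z) ≃ Y ⊕ (X ⊕ Z) :=
    ((Equiv.sumAssoc X Y Z).symm.trans ((Equiv.sumComm X Y).sumCongr (Equiv.refl Z))).trans
      (Equiv.sumAssoc Y X Z)
  rw [← card_quotient_map_equiv _ e]
  have e1 : e ∘ leftIncl = leftIncl ∘ Equiv.sumComm X Y := by
    funext v; rcases v with v | v <;> rfl
  have e2 : e ∘ rightIncl = outerIncl := by
    funext v; rcases v with v | v <;> rfl
  have e3 : e ∘ outerIncl = rightIncl := by
    funext v; rcases v with v | v <;> rfl
  rw [juxtapose, juxtapose, flip, map_sup, map_sup, map_map, map_map, map_map, map_map, e1, e2, e3,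
    sup_assoc, sup_assoc, sup_comm (x.map outerIncl)]

/-! ### Diagrams, left multiplication matrices and the trace Gram matrix. -/

namespace Diagram

theorem ext_partition {n : ℕ} {d e : Diagram n} (h : d.partition = e.partition) : d = e := by
  cases d; cases e; cases h; rfl

noncomputable instance instFintype (n : ℕ) : Fintype (Diagram n) := by
  have : Finite (Diagram n) :=
    Finite.of_injective (fun d v w => d.partition v w) fun d e h =>
      ext_partition (Setoid.ext fun v w => iff_of_eq (congrFun (congrFun h v) w))
  exact Fintype.ofFinite _

noncomputable instance instDecidableEq (n : ℕ) : DecidableEq (Diagram n) := Classical.decEq _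

/-- The reflected diagram. -/
def flip {n : ℕ} (d : Diagram n) : Diagram n :=
  ⟨PartialBrauer.flip d.partition, isPairing_flip d.isPairing⟩

theorem comp_id {n : ℕ} (d : Diagram n) : d.comp (Diagram.id n) = d :=
  ext_partition (PartialBrauer.comp_id d.partition)

/-- The number of singleton blocks. -/
noncomputable def numSingletons {n : ℕ} (d : Diagram n) : ℕ :=
  Nat.card {x // IsSingleton d.partition x}

end Diagram

/-- The matrix of left multiplication by a diagram, in the basis of diagrams. -/
noncomputable def mulMatrix {k : Type*} [CommRing k] (δ δ' : k) {n : ℕ} (d : Diagram n) :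
    Matrix (Diagram n) (Diagram n) k :=
  Matrix.of fun e' e => if d.comp e = e' then factor δ δ' d e else 0

/-- The Gram matrix of the regular trace form, in the basis of diagrams. -/
noncomputable def traceMatrix {k : Type*} [CommRing k] (δ δ' : k) (n : ℕ) :
    Matrix (Diagram n) (Diagram n) k :=
  Matrix.of fun d d' => (mulMatrix δ δ' d * mulMatrix δ δ' d').trace

theorem map_mulMatrix {k l : Type*} [CommRing k] [CommRing l] (f : k →+* l) (δ δ' : k) {n : ℕ}
    (d : Diagram n) : (mulMatrix δ δ' d).map f = mulMatrix (f δ) (f δ') d := by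
  ext e' e
  simp [mulMatrix, factor, apply_ite f]

/-- Compatibility with ring homomorphisms lets a single polynomial over `ℤ` be evaluated at real and
at complex parameters. -/
theorem map_det_traceMatrix {k l : Type*} [CommRing k] [CommRing l] (f : k →+* l) (δ δ' : k)
    (n : ℕ) : f (traceMatrix δ δ' n).det = (traceMatrix (f δ) (f δ') n).det := by
  rw [RingHom.map_det]
  congr 1
  ext d d'
  simp [traceMatrix, ← map_mulMatrix f, ← Matrix.map_mul, Matrix.trace, Matrix.diag]

/-- The singleton count of `numStrings_eq` gives this intertwining relation: with `D` the diagonal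
matrix of the `ε ^ e.numSingletons` and `ε` invertible, the matrix of `d` at `ε ^ 2` is `ε ^
d.numSingletons` times the conjugate by `D` of its matrix at `1`. No division is used here. -/
theorem mulMatrix_sq {k : Type*} [CommRing k] (δ ε : k) {n : ℕ} (d e' e : Diagram n) :
    ε ^ e'.numSingletons * mulMatrix δ (ε ^ 2) d e' e =
      ε ^ d.numSingletons * (mulMatrix δ 1 d e' e * ε ^ e.numSingletons) := by
  by_cases h : d.comp e = e'
  · have hs : d.numSingletons + e.numSingletons =
        2 * numStrings d.partition e.partition + e'.numSingletons := by
      rw [← h]; exact numStrings_eq d.isPairing e.isPairing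
    simp only [mulMatrix, Matrix.of_apply, if_pos h, factor, one_pow, mul_one, ← pow_mul]
    calc _ = δ ^ numLoops d.partition e.partition *
          ε ^ (2 * numStrings d.partition e.partition + e'.numSingletons) := by ring
      _ = _ := by rw [← hs]; ring
  · simp [mulMatrix, h]

/-- The parameter of the open strings only rescales the basis of diagrams. -/
theorem det_traceMatrix_sq {k : Type*} [Field k] (δ ε : k) (hε : ε ≠ 0) (n : ℕ) :
    (traceMatrix δ (ε ^ 2) n).det =
      (∏ d : Diagram n, ε ^ d.numSingletons) ^ 2 * (traceMatrix δ 1 n).det := by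
  have hentry : ∀ d e' e : Diagram n, mulMatrix δ (ε ^ 2) d e' e =
      ε ^ d.numSingletons * mulMatrix δ 1 d e' e *
        (ε ^ e.numSingletons / ε ^ e'.numSingletons) := by
    intro d e' e
    have := mulMatrix_sq δ ε d e' e
    field_simp
    linear_combination this
  have h : traceMatrix δ (ε ^ 2) n =
      Matrix.diagonal (fun d : Diagram n => ε ^ d.numSingletons) * traceMatrix δ 1 n *
        Matrix.diagonal (fun d : Diagram n => ε ^ d.numSingletons) := by
    ext d d'
    rw [Matrix.mul_diagonal, Matrix.diagonal_mul]
    simp only [traceMatrix, Matrix.of_apply, Matrix.trace, Matrix.diag, Matrix.mul_apply,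
      Finset.mul_sum, Finset.sum_mul, hentry]
    -- The conjugating powers attached to `e` and `f` cancel under the trace, leaving only those of
    -- `d` and `d'`.
    refine Finset.sum_congr rfl fun e _ => Finset.sum_congr rfl fun f _ => ?_
    field_simp
  rw [h, Matrix.det_mul, Matrix.det_mul, Matrix.det_diagonal]
  ring

theorem linearIndependent_mulMatrix {k : Type*} [CommRing k] (δ δ' : k) (n : ℕ) :
    LinearIndependent k fun d : Diagram n => mulMatrix δ δ' d := by
  rw [Fintype.linearIndependent_iff]
  intro g hg d
  -- Since `d ∘ id = d` with factor one, the column at the identity of the matrix of `d` is the unit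
  -- vector at `d`.
  have := congrFun (congrFun hg d) (Diagram.id n)
  simpa [Matrix.sum_apply, mulMatrix, Diagram.comp_id, factor_id_right] using this

/-! ### An invariant form, positive definite for large parameter. -/

/-- The form for which the reflection of diagrams is the adjoint, if both parameters agree. -/
noncomputable def closureForm (δ : ℝ) (n : ℕ) : Matrix (Diagram n) (Diagram n) ℝ :=
  Matrix.of fun d e => δ ^ Nat.card (Quotient (d.partition ⊔ e.partition))

theorem factor_self {k : Type*} [CommRing k] (δ : k) {n : ℕ} (d e : Diagram n) :
    factor δ δ d e = δ ^ Nat.card {c // IsRemoved d.partition e.partition c} := by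
  rw [factor, ← pow_add, numLoops_add_numStrings]

/-- The exponents at `(y, x)` on both sides count the components obtained by gluing `d`, `x` and `y`
together. Equal parameters are essential: the count does not tell loops from open strings. -/
theorem closureForm_mul_mulMatrix (δ : ℝ) {n : ℕ} (d : Diagram n) :
    closureForm δ n * mulMatrix δ δ d = (mulMatrix δ δ d.flip).transpose * closureForm δ n := by
  ext y x
  simp only [Matrix.mul_apply, closureForm, mulMatrix, Matrix.of_apply, Matrix.transpose_apply,
    mul_ite, ite_mul, mul_zero, zero_mul, Finset.sum_ite_eq, Finset.mem_univ, if_true,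
    factor_self, ← pow_add]
  rw [add_comm]
  exact congrArg _ (card_removed_flip d.partition x.partition y.partition)

/-- The parameter is a square so that the diagonal entries are squares of `t ^ #blocks`, which serve
as the weights. -/
theorem posDef_closureForm (n : ℕ) {t : ℝ} (ht : (Fintype.card (Diagram n) : ℝ) + 1 ≤ t) :
    (closureForm (t ^ 2) n).PosDef := by
  have ht1 : 1 ≤ t := le_trans (by simp) ht
  have ht0 : 0 < t := one_pos.trans_le ht1
  refine Matrix.posDef_of_offDiag_small (t := t) ?_
    (fun d => t ^ Nat.card (Quotient d.partition)) (fun d => pow_pos ht0 _) ?_ (by linarith) ?_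
  · ext d e
    simp [closureForm, sup_comm]
  · intro d
    simp [closureForm, ← pow_mul, mul_comm]
  · intro d e hde
    have h := two_mul_card_sup_lt fun h => hde (Diagram.ext_partition h)
    simp only [closureForm, Matrix.of_apply, ← pow_mul]
    rw [abs_of_pos (pow_pos ht0 _), ← pow_succ', ← pow_add]
    -- The strict inequality `h` is read as `2 * #(d ⊔ e) + 1 ≤ #d + #e`; the extra one absorbs the
    -- factor `t`.
    exact pow_le_pow_right₀ ht1 h

/-- Nondegeneracy is available at `δ = δ' = t ^ 2`; rescaling with `ε = t` carries it over to `δ' =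
1`. -/
theorem exists_det_traceMatrix_ne_zero (n : ℕ) : ∃ δ : ℝ, (traceMatrix δ 1 n).det ≠ 0 := by
  set t : ℝ := Fintype.card (Diagram n) + 1 with ht
  have ht0 : t ≠ 0 := by positivity
  refine ⟨t ^ 2, fun h => ?_⟩
  refine Matrix.det_trace_mul_ne_zero (posDef_closureForm n ht.ge)
    (mulMatrix (t ^ 2) (t ^ 2)) (linearIndependent_mulMatrix _ _ n) Diagram.flip
    (closureForm_mul_mulMatrix (t ^ 2)) ?_
  exact (det_traceMatrix_sq (t ^ 2) t ht0 n).trans (by rw [h, mul_zero])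

end PartialBrauer

/-! ### Transfer to the algebra and the exceptional set. -/

namespace PartialBrauerAlgebra

theorem basis_mul_basis {k : Type*} [CommRing k] {n : ℕ} (δ δ' : k)
    (d e : PartialBrauer.Diagram n) :
    basis k n δ δ' d * basis k n δ δ' e =
      PartialBrauer.factor δ δ' d e • basis k n δ δ' (d.comp e) :=
  mulLin_basis δ δ' d e

theorem toMatrix_mulLeft_basis {k : Type*} [CommRing k] {n : ℕ} (δ δ' : k)
    (d : PartialBrauer.Diagram n) :
    LinearMap.toMatrix (basis k n δ δ') (basis k n δ δ')
      (LinearMap.mulLeft k (basis k n δ δ' d)) = PartialBrauer.mulMatrix δ δ' d := by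
  ext e' e
  simp [LinearMap.toMatrix_apply, basis_mul_basis, PartialBrauer.mulMatrix,
    Finsupp.single_apply]

theorem isSemisimpleRing_of_det_ne_zero {k : Type*} [Field k] {n : ℕ} {δ δ' : k}
    (h : (PartialBrauer.traceMatrix δ δ' n).det ≠ 0) :
    IsSemisimpleRing (PartialBrauerAlgebra k n δ δ') := by
  refine isSemisimpleRing_of_det_trace_ne_zero (basis k n δ δ') ?_
  convert h using 2
  ext d e
  rw [Matrix.of_apply, LinearMap.mulLeft_mul, LinearMap.trace_eq_matrix_trace k (basis k n δ δ'),
    LinearMap.toMatrix_comp _ (basis k n δ δ'), toMatrix_mulLeft_basis, toMatrix_mulLeft_basis]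
  rfl

end PartialBrauerAlgebra

theorem corollary7 (n : ℕ) :
    ∃ S : Set ℂ, S.Finite ∧ ∀ δ δ' : ℂ, δ ∉ S → δ' ≠ 0 →
      IsSemisimpleRing (PartialBrauerAlgebra ℂ n δ δ') := by
  -- Integer coefficients allow nonvanishing to be tested at a real point while the roots are taken
  -- in `ℂ`.
  let P : Polynomial ℤ := (PartialBrauer.traceMatrix Polynomial.X 1 n).det
  have hP : ∀ {k : Type} [CommRing k] (δ : k),
      Polynomial.aeval δ P = (PartialBrauer.traceMatrix δ 1 n).det := by
    intro k _ δ
    have := PartialBrauer.map_det_traceMatrix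
      (Polynomial.aeval δ : Polynomial ℤ →ₐ[ℤ] k).toRingHom Polynomial.X 1 n
    simpa using this
  have hP0 : P ≠ 0 := by
    obtain ⟨δ, hδ⟩ := PartialBrauer.exists_det_traceMatrix_ne_zero n
    intro h
    rw [← hP, h, map_zero] at hδ
    exact hδ rfl
  -- The exceptional set depends on `n` alone, because `δ'` enters only through the nonzero factor
  -- of `det_traceMatrix_sq`.
  refine ⟨P.rootSet ℂ, P.rootSet_finite ℂ, fun δ δ' hδ hδ' => ?_⟩
  obtain ⟨ε, rfl⟩ := IsAlgClosed.exists_pow_nat_eq δ' two_pos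
  have hε : ε ≠ 0 := fun h => hδ' (by rw [h]; simp)
  apply PartialBrauerAlgebra.isSemisimpleRing_of_det_ne_zero
  rw [PartialBrauer.det_traceMatrix_sq δ ε hε, ← hP]
  refine mul_ne_zero (pow_ne_zero _ (Finset.prod_ne_zero_iff.2 fun d _ => pow_ne_zero _ hε)) ?_
  exact fun h => hδ ((Polynomial.mem_rootSet_of_ne hP0).2 h)
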